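/- **Theorem 1.1.** Let $d\ge 3$, put $g=\lfloor (d-1)/2\rfloor$, and let $W_0\subseteq \mathbb F_2^d$ be the subspace of vectors with coordinate sum $0$. Let $\bar V=W_0$ if $d$ is odd, and $\bar V=W_0/\langle (1,\dots,1)\rangle$ if $d$ is even; it has dimension $2g$. It carries the alternating pairing induced by the dot product $\langle v,w\rangle=\sum_i v_iw_i$, and the symmetric group $S_d$ acts on it by permuting coordinates and preserves this pairing (the standard representation $\rho : S_d\to \mathrm{Sp}(\bar V)$). Let $V$ be a free $\mathbb Z_2$-module of rank $2g$ with an alternating $\mathbb Z_2$-bilinear pairing $\langle\cdot,\cdot\rangle : V\times V\to\mathbb Z_2$, together with an identification $V/2V\cong\bar V$ under which the reduction modulo $2$ of the pairing on $V$ is the pairing on $\bar V$. Let $\mathrm{Sp}(V)$ be the group of automorphisms of $V$ preserving the pairing, with the $2$-adic topology. For $n\ge 1$ let $\varpi_{2^n}:\mathrm{Sp}(V)\to\mathrm{Sp}(V/2^nV)$ be the reduction map and $\Gamma(2^n)$ its kernel. Let $\mathfrak S_d\subseteq \mathrm{Sp}(V/2V)$ be the image of $S_d$ under $\rho$. Let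 $G\subseteq \mathrm{Sp}(V)$ be a closed subgroup with $\varpi_2(G)\supseteq \mathfrak S_d$. (a) If $d\ge 6$ is even, then $G=\varpi_2^{-1}(\varpi_2(G))$; thus $G$ is open in $\mathrm{Sp}(V)$ and $G\supseteq\Gamma(2)$. (b) If $d\ge 5$ is odd, then $G\supseteq \Gamma(8)$, and so $G$ is open in $\mathrm{Sp}(V)$. If moreover $\varpi_2(G)=\mathfrak S_d$ and $G\not\supseteq\Gamma(4)$, then $\#\varpi_8(G)=d!\cdot 2^{4g^2-2g}$. Any two closed subgroups $G,G'\subseteq\mathrm{Sp}(V)$ with $\varpi_2(G)=\varpi_2(G')=\mathfrak S_d$, neither of which contains $\Gamma(4)$, are conjugate by an element of $\varpi_2^{-1}(\mathfrak S_d)$. -/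

import Mathlib

open scoped Topology

/-! ### Symplectic groups -/

/-- The group `Sp(M)` of `R`-linear automorphisms of `M` which preserve the bilinear pairing `B`
(with values in an `R`-module `P`). -/
def Sp {R M P : Type*} [CommRing R] [AddCommGroup M] [Module R M] [AddCommGroup P] [Module R P]
    (B : M →ₗ[R] M →ₗ[R] P) : Subgroup (M ≃ₗ[R] M) where
  carrier := {f | ∀ v w, B (f v) (f w) = B v w}
  mul_mem' := by
    intro f k hf hk v w
    simp only [LinearEquiv.mul_apply]
    rw [hf, hk]
  one_mem' := by intro v w; rfl
  inv_mem' := by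
    intro f hf v w
    have h := hf (f⁻¹ v) (f⁻¹ w)
    have e : ∀ x, f (f⁻¹ x) = x := fun x => LinearEquiv.apply_symm_apply f x
    rw [e, e] at h
    exact h.symm

/-! ### The standard representation of the symmetric group over the field with two elements -/

/-- The `S_d`-invariant subspace `W_0` of `W = 𝔽₂^d` of vectors with coordinate sum `0`. -/
def sumZero (d : ℕ) : Submodule (ZMod 2) (Fin d → ZMod 2) where
  carrier := {w | ∑ i, w i = 0}
  add_mem' := by
    intro a b ha hb
    simp only [Set.mem_ofPred_eq, Pi.add_apply, Finset.sum_add_distrib] at *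
    rw [ha, hb, add_zero]
  zero_mem' := by simp
  smul_mem' := by
    intro c x hx
    simp only [Set.mem_ofPred_eq, Pi.smul_apply, ← Finset.smul_sum] at *
    rw [hx, smul_zero]

/-- The intersection of `W_0` with the line spanned by the all-ones vector `w_0`.  It is the
line spanned by `w_0` if `d` is even, and it is zero if `d` is odd
(see `onesLine_eq_bot_of_odd`). -/
def onesLine (d : ℕ) : Submodule (ZMod 2) (sumZero d) :=
  (Submodule.span (ZMod 2) {(fun _ => 1 : Fin d → ZMod 2)}).comap (sumZero d).subtype

theorem mem_onesLine {d : ℕ} {w : sumZero d} :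
    w ∈ onesLine d ↔ ∃ c : ZMod 2, ∀ i, w.1 i = c := by
  unfold onesLine
  rw [Submodule.mem_comap, Submodule.mem_span_singleton]
  constructor
  · rintro ⟨c, hc⟩
    refine ⟨c, fun i => ?_⟩
    have := congrFun hc i
    simpa using this.symm
  · rintro ⟨c, hc⟩
    refine ⟨c, ?_⟩
    funext i
    simpa using (hc i).symm

theorem onesLine_eq_bot_of_odd {d : ℕ} (hd : Odd d) : onesLine d = ⊥ := by
  rw [eq_bot_iff]
  intro w hw
  obtain ⟨c, hc⟩ := mem_onesLine.1 hw
  have h : ∑ i, w.1 i = 0 := w.2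
  have hd' : (d : ZMod 2) = 1 := (ZMod.natCast_eq_one_iff_odd).2 hd
  simp only [hc, Finset.sum_const, Finset.card_univ, Fintype.card_fin, nsmul_eq_mul, hd',
    one_mul] at h
  rw [Submodule.mem_bot]
  apply Subtype.ext
  funext i
  rw [hc i, h]
  rfl

/-- The space of the standard representation of `S_d` over `𝔽₂`: the space `W_0` for odd `d`, and
`W_0 / ⟨w_0⟩` for even `d`.  (For odd `d` the quotient is by the zero subspace.) -/
abbrev StdSpace (d : ℕ) : Type := sumZero d ⧸ onesLine d

/-- The dot product on `W_0`; for `v_I = ∑_{i ∈ I} e_i` it gives `⟨v_I, v_J⟩ = #(I ∩ J)` mod 2. -/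
def dotForm (d : ℕ) : sumZero d →ₗ[ZMod 2] sumZero d →ₗ[ZMod 2] ZMod 2 :=
  LinearMap.mk₂ (ZMod 2) (fun v w => ∑ i, v.1 i * w.1 i)
    (by intro a b c; simp [add_mul, Finset.sum_add_distrib])
    (by intro a b c; simp [mul_assoc, Finset.mul_sum])
    (by intro a b c; simp [mul_add, Finset.sum_add_distrib])
    (by intro a b c; simp [mul_left_comm, Finset.mul_sum])

theorem dotForm_apply {d : ℕ} (v w : sumZero d) : dotForm d v w = ∑ i, v.1 i * w.1 i := rfl

theorem dotForm_left {d : ℕ} {v : sumZero d} (hv : v ∈ onesLine d) (w : sumZero d) :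
    dotForm d v w = 0 := by
  obtain ⟨c, hc⟩ := mem_onesLine.1 hv
  have h : ∑ i, w.1 i = 0 := w.2
  simp only [dotForm_apply, hc, ← Finset.mul_sum, h, mul_zero]

theorem dotForm_right {d : ℕ} (v : sumZero d) {w : sumZero d} (hw : w ∈ onesLine d) :
    dotForm d v w = 0 := by
  obtain ⟨c, hc⟩ := mem_onesLine.1 hw
  have h : ∑ i, v.1 i = 0 := v.2
  simp only [dotForm_apply, hc, ← Finset.sum_mul, h, zero_mul]

/-- The alternating pairing on the space of the standard representation induced by the
dot product. -/
def stdForm (d : ℕ) : StdSpace d →ₗ[ZMod 2] StdSpace d →ₗ[ZMod 2] ZMod 2 :=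
  (onesLine d).liftQ
    { toFun := fun v => (onesLine d).liftQ (dotForm d v) (fun _ hw => dotForm_right v hw)
      map_add' := by
        intro a b
        refine LinearMap.ext fun x => ?_
        obtain ⟨w, rfl⟩ := (onesLine d).mkQ_surjective x
        exact LinearMap.map_add₂ (dotForm d) a b w
      map_smul' := by
        intro c a
        refine LinearMap.ext fun x => ?_
        obtain ⟨w, rfl⟩ := (onesLine d).mkQ_surjective x
        exact LinearMap.map_smul₂ (dotForm d) c a w }
    (by
      intro v hv
      rw [LinearMap.mem_ker]
      refine LinearMap.ext fun x => ?_
      obtain ⟨w, rfl⟩ := (onesLine d).mkQ_surjective x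
      exact dotForm_left hv w)

theorem stdForm_mk {d : ℕ} (v w : sumZero d) :
    stdForm d ((onesLine d).mkQ v) ((onesLine d).mkQ w) = ∑ i, v.1 i * w.1 i := rfl

/-- The action of a permutation on `W_0`, which sends `e_i` to `e_{σ i}`. -/
def permSumZero {d : ℕ} (σ : Equiv.Perm (Fin d)) : sumZero d →ₗ[ZMod 2] sumZero d where
  toFun w := ⟨fun i => w.1 (σ⁻¹ i), by
    have h : ∑ i, w.1 i = 0 := w.2
    change ∑ i, w.1 (σ⁻¹ i) = 0
    rw [← h]
    exact Equiv.sum_comp σ⁻¹ w.1⟩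
  map_add' _ _ := rfl
  map_smul' _ _ := rfl

/-- The action of a permutation on the space of the standard representation. -/
def permStd {d : ℕ} (σ : Equiv.Perm (Fin d)) : StdSpace d →ₗ[ZMod 2] StdSpace d :=
  (onesLine d).mapQ (onesLine d) (permSumZero σ) (by
    intro w hw
    obtain ⟨c, hc⟩ := mem_onesLine.1 hw
    exact mem_onesLine.2 ⟨c, fun i => hc (σ⁻¹ i)⟩)

theorem permStd_mk {d : ℕ} (σ : Equiv.Perm (Fin d)) (w : sumZero d) :
    permStd σ ((onesLine d).mkQ w) = (onesLine d).mkQ (permSumZero σ w) := rfl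

theorem permStd_mul {d : ℕ} (σ τ : Equiv.Perm (Fin d)) (x : StdSpace d) :
    permStd (σ * τ) x = permStd σ (permStd τ x) := by
  obtain ⟨w, rfl⟩ := (onesLine d).mkQ_surjective x
  simp only [permStd_mk]
  congr 1

theorem permStd_one {d : ℕ} (x : StdSpace d) : permStd (1 : Equiv.Perm (Fin d)) x = x := by
  obtain ⟨w, rfl⟩ := (onesLine d).mkQ_surjective x
  rfl

theorem stdForm_permStd {d : ℕ} (σ : Equiv.Perm (Fin d)) (x y : StdSpace d) :
    stdForm d (permStd σ x) (permStd σ y) = stdForm d x y := by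
  obtain ⟨v, rfl⟩ := (onesLine d).mkQ_surjective x
  obtain ⟨w, rfl⟩ := (onesLine d).mkQ_surjective y
  rw [permStd_mk, permStd_mk, stdForm_mk, stdForm_mk]
  exact Equiv.sum_comp σ⁻¹ (fun i => v.1 i * w.1 i)

/-- The standard representation `ρ : S_d → Sp(StdSpace d)` over `𝔽₂`. -/
def stdRep (d : ℕ) : Equiv.Perm (Fin d) →* Sp (stdForm d) where
  toFun σ := ⟨LinearEquiv.ofLinearMap (permStd σ) (permStd σ⁻¹)
      (by
        refine LinearMap.ext fun x => ?_
        rw [LinearMap.comp_apply, ← permStd_mul, mul_inv_cancel, permStd_one, LinearMap.id_apply])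
      (by
        refine LinearMap.ext fun x => ?_
        rw [LinearMap.comp_apply, ← permStd_mul, inv_mul_cancel, permStd_one, LinearMap.id_apply]), stdForm_permStd σ⟩
  map_one' := by
    apply Subtype.ext
    apply LinearEquiv.ext
    exact permStd_one
  map_mul' σ τ := by
    apply Subtype.ext
    apply LinearEquiv.ext
    exact permStd_mul σ τ

/-! ### Reduction of a symplectic module over the 2-adic integers -/

section Reduction

variable {V : Type*} [AddCommGroup V] [Module ℤ_[2] V]

/-- The submodule `m V` of `V`. -/
noncomputable def multiples (V : Type*) [AddCommGroup V] [Module ℤ_[2] V] (m : ℕ) : Submodule ℤ_[2] V :=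
  LinearMap.range (LinearMap.lsmul ℤ_[2] V (m : ℤ_[2]))

theorem mem_multiples {m : ℕ} {v : V} : v ∈ multiples V m ↔ ∃ w : V, (m : ℤ_[2]) • w = v :=
  Iff.rfl

/-- The reduction `V / m V`. -/
abbrev Red (V : Type*) [AddCommGroup V] [Module ℤ_[2] V] (m : ℕ) : Type _ := V ⧸ multiples V m

/-- The pairing on `V / m V` induced by a pairing on `V`, with values in `ℤ₂ / m ℤ₂`. -/
noncomputable def redForm (B : V →ₗ[ℤ_[2]] V →ₗ[ℤ_[2]] ℤ_[2]) (m : ℕ) :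
    Red V m →ₗ[ℤ_[2]] Red V m →ₗ[ℤ_[2]] Red ℤ_[2] m :=
  (multiples V m).liftQ
    { toFun := fun v => (multiples V m).mapQ (multiples ℤ_[2] m) (B v) (by
        rintro _ ⟨w, rfl⟩
        exact ⟨B v w, by simp⟩)
      map_add' := by
        intro a b
        refine LinearMap.ext fun x => ?_
        obtain ⟨w, rfl⟩ := (multiples V m).mkQ_surjective x
        exact congrArg (multiples ℤ_[2] m).mkQ (LinearMap.map_add₂ B a b w)
      map_smul' := by
        intro c a
        refine LinearMap.ext fun x => ?_
        obtain ⟨w, rfl⟩ := (multiples V m).mkQ_surjective x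
        exact congrArg (multiples ℤ_[2] m).mkQ (LinearMap.map_smul₂ B c a w) }
    (by
      rintro _ ⟨v, rfl⟩
      rw [LinearMap.mem_ker]
      refine LinearMap.ext fun x => ?_
      obtain ⟨w, rfl⟩ := (multiples V m).mkQ_surjective x
      refine (Submodule.Quotient.mk_eq_zero (multiples ℤ_[2] m)).2 ⟨B v w, ?_⟩
      exact (LinearMap.map_smul₂ B (m : ℤ_[2]) v w).symm)

theorem redForm_mk (B : V →ₗ[ℤ_[2]] V →ₗ[ℤ_[2]] ℤ_[2]) (m : ℕ) (v w : V) :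
    redForm B m ((multiples V m).mkQ v) ((multiples V m).mkQ w)
      = (multiples ℤ_[2] m).mkQ (B v w) := rfl

theorem map_multiples (f : V ≃ₗ[ℤ_[2]] V) (m : ℕ) :
    multiples V m ≤ (multiples V m).comap (f : V →ₗ[ℤ_[2]] V) := by
  rintro _ ⟨w, rfl⟩
  exact ⟨f w, by simp⟩

/-- The endomorphism of `V / m V` induced by an automorphism of `V`. -/
noncomputable def redMap (f : V ≃ₗ[ℤ_[2]] V) (m : ℕ) : Red V m →ₗ[ℤ_[2]] Red V m :=
  (multiples V m).mapQ (multiples V m) (f : V →ₗ[ℤ_[2]] V) (map_multiples f m)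

theorem redMap_mk (f : V ≃ₗ[ℤ_[2]] V) (m : ℕ) (v : V) :
    redMap f m ((multiples V m).mkQ v) = (multiples V m).mkQ (f v) := rfl

theorem redMap_mul (f k : V ≃ₗ[ℤ_[2]] V) (m : ℕ) (x : Red V m) :
    redMap (f * k) m x = redMap f m (redMap k m x) := by
  obtain ⟨v, rfl⟩ := (multiples V m).mkQ_surjective x
  rfl

theorem redMap_one (m : ℕ) (x : Red V m) : redMap (1 : V ≃ₗ[ℤ_[2]] V) m x = x := by
  obtain ⟨v, rfl⟩ := (multiples V m).mkQ_surjective x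
  rfl

theorem redForm_redMap (B : V →ₗ[ℤ_[2]] V →ₗ[ℤ_[2]] ℤ_[2]) (m : ℕ) (f : Sp B) (x y : Red V m) :
    redForm B m (redMap f.1 m x) (redMap f.1 m y) = redForm B m x y := by
  obtain ⟨v, rfl⟩ := (multiples V m).mkQ_surjective x
  obtain ⟨w, rfl⟩ := (multiples V m).mkQ_surjective y
  rw [redMap_mk, redMap_mk, redForm_mk, redForm_mk, f.2 v w]

/-- The reduction map `ϖ_m : Sp(V) → Sp(V / m V)`.  Automorphisms of `V / m V` as a `ℤ₂`-module
are the same as automorphisms as a `ℤ / m`-module when `m` is a power of `2`. -/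
noncomputable def redSp (B : V →ₗ[ℤ_[2]] V →ₗ[ℤ_[2]] ℤ_[2]) (m : ℕ) : Sp B →* Sp (redForm B m) where
  toFun f := ⟨LinearEquiv.ofLinearMap (redMap f.1 m) (redMap f.1⁻¹ m)
      (by
        refine LinearMap.ext fun x => ?_
        rw [LinearMap.comp_apply, ← redMap_mul, mul_inv_cancel, redMap_one, LinearMap.id_apply])
      (by
        refine LinearMap.ext fun x => ?_
        rw [LinearMap.comp_apply, ← redMap_mul, inv_mul_cancel, redMap_one, LinearMap.id_apply]),
    redForm_redMap B m f⟩
  map_one' := by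
    apply Subtype.ext
    apply LinearEquiv.ext
    exact redMap_one m
  map_mul' f k := by
    apply Subtype.ext
    apply LinearEquiv.ext
    exact redMap_mul f.1 k.1 m

/-- The principal congruence subgroup `Γ(m)`, the kernel of the reduction `Sp(V) → Sp(V / m V)`. -/
noncomputable def Gam (B : V →ₗ[ℤ_[2]] V →ₗ[ℤ_[2]] ℤ_[2]) (m : ℕ) : Subgroup (Sp B) := (redSp B m).ker

/-- The 2-adic topology on `Sp(V)`: the coarsest topology for which all the reduction maps
`Sp(V) → Sp(V / 2^n V)` to discrete groups are continuous. -/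
@[reducible]
noncomputable def twoAdic (B : V →ₗ[ℤ_[2]] V →ₗ[ℤ_[2]] ℤ_[2]) : TopologicalSpace (Sp B) :=
  ⨅ n : ℕ, TopologicalSpace.induced (redSp B (2 ^ n)) ⊥

/-- The subgroup `𝔖_d` of `Sp(V / 2V)`: the automorphisms which correspond, under an
identification `e` of `V / 2V` with the space of the standard representation, to elements of the
image of the standard representation of `S_d`. -/
noncomputable def stdImage (B : V →ₗ[ℤ_[2]] V →ₗ[ℤ_[2]] ℤ_[2]) (d : ℕ) (e : Red V 2 ≃+ StdSpace d) :
    Subgroup (Sp (redForm B 2)) where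
  carrier := {f | ∃ s ∈ (stdRep d).range, ∀ x, e (f.1 x) = s.1 (e x)}
  mul_mem' := by
    rintro f k ⟨s, hs, h⟩ ⟨t, ht, h'⟩
    refine ⟨s * t, mul_mem hs ht, fun x => ?_⟩
    change e (f.1 (k.1 x)) = s.1 (t.1 (e x))
    rw [h, h']
  one_mem' := ⟨1, one_mem _, fun _ => rfl⟩
  inv_mem' := by
    rintro f ⟨s, hs, h⟩
    refine ⟨s⁻¹, inv_mem hs, fun x => ?_⟩
    have h1 := h ((f⁻¹).1 x)
    have h2 : f.1 ((f⁻¹).1 x) = x := LinearEquiv.apply_symm_apply f.1 x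
    rw [h2] at h1
    rw [h1]
    exact (LinearEquiv.symm_apply_apply s.1 _).symm

end Reduction

/-!
For `a = 1 + 2 ^ n A` in `Γ(2 ^ n)` the reduction of `A` modulo `2` is the symbol of `a`, a
self-adjoint endomorphism of `V̄` if `n ≥ 1`. The symbols of `G ∩ Γ(2 ^ (n + 1))` form the layer
`Lₙ` of `G`, a space of self-adjoint endomorphisms stable under `S_d`. Squaring elements of `G`
gives `Lₙ ≤ Lₙ₊₁` for `n ≥ 1` and `X + X² ∈ L₁` for `X ∈ L₀`. A closed `G` contains
`Γ(2 ^ (n + 1))` once `Lₙ, Lₙ₊₁, …` are full, and an `S_d`-stable space which strictly contains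
the space of alternating endomorphisms is full.

Squares of lifts of transpositions to `G` show that `L₀` contains all alternating endomorphisms.
If `L₀` contains nothing else, comparing a lift of the transposition of `i` and `j` with a
transvection yields a vector of sum `0` whose `i`-th and `j`-th coordinates differ and whose other
coordinates agree. Such a vector exists only for odd `d`, so `Γ(2) ≤ G` for even `d`.

For odd `d`, if `L₀` is not full, commutators of lifts of disjoint transpositions show that `L₁`
contains all alternating endomorphisms. Suitable elements of `G` with idempotent symbols in `L₀`
produce an element of `L₂` which is not alternating, hence `Γ(8) ≤ G`. If `Γ(4)` is not contained
in `G`, then `L₀` and `L₁` are both the space of alternating endomorphisms, which gives the order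
of the reduction modulo `8`.

To conjugate such a `G` into another such group `H`, go up one power of `2` at a time. Given
`g ∈ G` and `h ∈ H` with the same reduction, the obstruction is the diagonal of the symbol of
`g⁻¹ h`, a crossed homomorphism with values in `V̄`. On `S_d` it is a coboundary, since `d` is
odd, and conjugation with a transvection removes it. At the second step it vanishes on `G ∩ Γ(2)`,
because there is no nonzero `S_d`-equivariant linear map from the alternating endomorphisms to
`V̄`.
-/

/-! ### Alternating endomorphisms -/

section AlternatingEndomorphisms

variable {W : Type*} [AddCommGroup W] [Module (ZMod 2) W] (ω : LinearMap.BilinForm (ZMod 2) W)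

/-- The image `x²` of `x ⊗ x` under the identification of `W ⊗ W` with `End W` given by the
form: the endomorphism `z ↦ ⟨z, x⟩ x`. -/
def squareEnd (x : W) : Module.End (ZMod 2) W := (ω.flip x).smulRight x

/-- The image `x ∧ y` of `x ⊗ y + y ⊗ x` under the identification of `W ⊗ W` with `End W` given
by the form: the endomorphism `z ↦ ⟨z, x⟩ y + ⟨z, y⟩ x`, as a bilinear function of `x` and `y`. -/
def wedgeEnd : W →ₗ[ZMod 2] W →ₗ[ZMod 2] Module.End (ZMod 2) W :=
  LinearMap.mk₂ (ZMod 2) (fun x y => (ω.flip x).smulRight y + (ω.flip y).smulRight x)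
    (fun x y z => by ext; simp [add_smul]; abel)
    (fun c x y => by ext; simp [smul_smul, mul_comm])
    (fun x y z => by ext; simp [add_smul]; abel)
    (fun c x y => by ext; simp [smul_smul, mul_comm])

/-- The endomorphisms `X` for which the bilinear form `⟨X x, y⟩` is alternating. -/
def alternatingEnd : Submodule (ZMod 2) (Module.End (ZMod 2) W) where
  carrier := {X | ∀ x, ω (X x) x = 0}
  add_mem' hX hY x := by simp [hX x, hY x]
  zero_mem' := by simp
  smul_mem' c X hX x := by simp [hX x]

theorem zmod_two_eq_zero_or_one (c : ZMod 2) : c = 0 ∨ c = 1 := by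
  revert c; decide

theorem zmod_two_mul_self (c : ZMod 2) : c * c = c := by
  revert c; decide

variable {ω}

theorem squareEnd_apply (x z : W) : squareEnd ω x z = ω z x • x := rfl

theorem wedgeEnd_apply (x y z : W) : wedgeEnd ω x y z = ω z x • y + ω z y • x := rfl

theorem wedgeEnd_comm (x y : W) : wedgeEnd ω x y = wedgeEnd ω y x :=
  LinearMap.ext fun _ => add_comm _ _

theorem wedgeEnd_self (x : W) : wedgeEnd ω x x = 0 :=
  LinearMap.ext fun _ => ZModModule.add_self _

theorem squareEnd_zero : squareEnd ω 0 = 0 :=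
  LinearMap.ext fun _ => smul_zero _

theorem squareEnd_add (x y : W) :
    squareEnd ω (x + y) = squareEnd ω x + squareEnd ω y + wedgeEnd ω x y := by
  ext z
  simp only [LinearMap.add_apply, squareEnd_apply, wedgeEnd_apply, map_add, smul_add, add_smul]
  abel

theorem mem_selfAdjointSubmodule_iff_apply {X : Module.End (ZMod 2) W} :
    X ∈ ω.selfAdjointSubmodule ↔ ∀ x y, ω (X x) y = ω x (X y) :=
  LinearMap.mem_selfAdjointSubmodule X

theorem alternatingEnd_le_selfAdjointSubmodule (hω : ω.IsSymm) :
    alternatingEnd ω ≤ ω.selfAdjointSubmodule := by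
  refine fun X hX => mem_selfAdjointSubmodule_iff_apply.2 fun x y => ?_
  have h : ω (X x) y + ω (X y) x = 0 := by
    have h := hX (x + y)
    simpa only [map_add, LinearMap.add_apply, hX x, hX y, zero_add, add_zero, add_comm] using h
  rw [hω.eq x]
  exact CharTwo.add_eq_zero.1 h

theorem wedgeEnd_mem_alternatingEnd (hω : ω.IsSymm) (x y : W) :
    wedgeEnd ω x y ∈ alternatingEnd ω := by
  intro z
  simp only [wedgeEnd_apply, map_smul, LinearMap.smul_apply, smul_eq_mul, map_add,
    LinearMap.add_apply]
  rw [hω.eq x z, hω.eq y z, mul_comm, CharTwo.add_self_eq_zero]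

theorem squareEnd_mem_selfAdjointSubmodule (hω : ω.IsSymm) (x : W) :
    squareEnd ω x ∈ ω.selfAdjointSubmodule :=
  mem_selfAdjointSubmodule_iff_apply.2 fun y z => by
    rw [squareEnd_apply, squareEnd_apply, map_smul, map_smul, LinearMap.smul_apply, hω.eq x z,
      smul_eq_mul, smul_eq_mul, mul_comm]

theorem apply_squareEnd_self (hω : ω.IsSymm) (w x : W) : ω (squareEnd ω w x) x = ω x w := by
  rw [squareEnd_apply, map_smul, LinearMap.smul_apply, hω.eq w x, smul_eq_mul, zmod_two_mul_self]

theorem wedgeEnd_mul_self (hω : ω.IsAlt) (hs : ω.IsSymm) {x y : W} (h : ω x y = 1) :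
    wedgeEnd ω x y * wedgeEnd ω x y = wedgeEnd ω x y := by
  have hx : wedgeEnd ω x y x = x := by
    rw [wedgeEnd_apply, hω.self_eq_zero, h, zero_smul, one_smul, zero_add]
  have hy : wedgeEnd ω x y y = y := by
    rw [wedgeEnd_apply, hω.self_eq_zero, hs.eq, h, zero_smul, one_smul, add_zero]
  ext z
  rw [Module.End.mul_apply, wedgeEnd_apply x y z, map_add, map_smul, map_smul, hx, hy]

/-- The vector `w` is the diagonal of `X`: it represents the function `x ↦ ⟨X x, x⟩`, which is
linear when `X` is self-adjoint because squaring is additive over `𝔽₂`. -/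
def IsDiagonal (ω : LinearMap.BilinForm (ZMod 2) W) (X : Module.End (ZMod 2) W) (w : W) : Prop :=
  ∀ x, ω (X x) x = ω x w

theorem isDiagonal_squareEnd (hω : ω.IsSymm) (w : W) : IsDiagonal ω (squareEnd ω w) w :=
  apply_squareEnd_self hω w

theorem IsDiagonal.add {X Y : Module.End (ZMod 2) W} {v w : W} (hX : IsDiagonal ω X v)
    (hY : IsDiagonal ω Y w) : IsDiagonal ω (X + Y) (v + w) := fun x => by
  rw [LinearMap.add_apply, map_add, LinearMap.add_apply, hX, hY, map_add]

theorem isDiagonal_zero_iff {X : Module.End (ZMod 2) W} :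
    IsDiagonal ω X 0 ↔ X ∈ alternatingEnd ω := by
  simp only [IsDiagonal, map_zero]
  rfl

theorem IsDiagonal.add_squareEnd_mem (hω : ω.IsSymm) {X : Module.End (ZMod 2) W} {w : W}
    (hX : IsDiagonal ω X w) : X + squareEnd ω w ∈ alternatingEnd ω := by
  rw [← isDiagonal_zero_iff, ← ZModModule.add_self w]
  exact hX.add (isDiagonal_squareEnd hω w)

theorem eq_of_forall_apply_eq (hn : ω.Nondegenerate) {v w : W} (h : ∀ x, ω x v = ω x w) :
    v = w :=
  sub_eq_zero.1 (hn.2 _ fun x => by rw [map_sub, h, sub_self])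

theorem IsDiagonal.unique (hn : ω.Nondegenerate) {X : Module.End (ZMod 2) W} {v w : W}
    (hv : IsDiagonal ω X v) (hw : IsDiagonal ω X w) : v = w :=
  eq_of_forall_apply_eq hn fun x => (hv x).symm.trans (hw x)

section Basis

variable {ι : Type*} [LinearOrder ι] (b : Module.Basis ι (ZMod 2) W)

/-- The matrix coefficients `⟨X bᵢ, bⱼ⟩`, `i < j`, of an endomorphism. -/
noncomputable def upperCoeffs (ω : LinearMap.BilinForm (ZMod 2) W) (X : Module.End (ZMod 2) W)
    (p : {p : ι × ι // p.1 < p.2}) : ZMod 2 :=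
  ω (X (b p.1.1)) (b p.1.2)

variable {b}

theorem eq_of_upperCoeffs_eq (hω : ω.IsSymm) (hn : ω.Nondegenerate) {X Y : Module.End (ZMod 2) W}
    (hX : X ∈ alternatingEnd ω) (hY : Y ∈ alternatingEnd ω)
    (h : upperCoeffs b ω X = upperCoeffs b ω Y) : X = Y := by
  have hlt : ∀ i j, i < j → ω (X (b i)) (b j) = ω (Y (b i)) (b j) :=
    fun i j hij => congrFun h ⟨(i, j), hij⟩
  have hall : ∀ i j, ω (X (b i)) (b j) = ω (Y (b i)) (b j) := by
    intro i j
    rcases lt_trichotomy i j with hij | rfl | hij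
    · exact hlt i j hij
    · rw [hX, hY]
    · have hself := alternatingEnd_le_selfAdjointSubmodule hω
      rw [mem_selfAdjointSubmodule_iff_apply.1 (hself hX),
        mem_selfAdjointSubmodule_iff_apply.1 (hself hY), hω.eq, hω.eq (b i)]
      exact hlt j i hij
  have hcomp : ω.compLeft X = ω.compLeft Y := LinearMap.ext_basis b b hall
  refine LinearMap.ext fun x => eq_of_forall_apply_eq hn fun y => ?_
  rw [hω.eq, hω.eq y]
  exact LinearMap.congr_fun (LinearMap.congr_fun hcomp x) y

variable [Fintype ι]

variable (b) in
/-- The alternating endomorphism with prescribed coefficients `⟨X bᵢ, bⱼ⟩`, `i < j`, in terms of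
the dual basis. -/
noncomputable def ofUpperCoeffs (hn : ω.Nondegenerate) (f : {p : ι × ι // p.1 < p.2} → ZMod 2) :
    Module.End (ZMod 2) W :=
  ∑ p, f p • wedgeEnd ω (ω.dualBasis hn b p.1.1) (ω.dualBasis hn b p.1.2)

theorem ofUpperCoeffs_mem (hn : ω.Nondegenerate) {M : Submodule (ZMod 2) (Module.End (ZMod 2) W)}
    (h : ∀ x y, wedgeEnd ω x y ∈ M) (f : {p : ι × ι // p.1 < p.2} → ZMod 2) :
    ofUpperCoeffs b hn f ∈ M :=
  M.sum_mem fun _ _ => M.smul_mem _ (h _ _)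

theorem upperCoeffs_ofUpperCoeffs (hω : ω.IsSymm) (hn : ω.Nondegenerate)
    (f : {p : ι × ι // p.1 < p.2} → ZMod 2) : upperCoeffs b ω (ofUpperCoeffs b hn f) = f := by
  funext ⟨⟨k, l⟩, hkl⟩
  change k < l at hkl
  simp only [upperCoeffs, ofUpperCoeffs, LinearMap.sum_apply, map_sum]
  rw [Finset.sum_eq_single ⟨(k, l), hkl⟩]
  · simp [wedgeEnd_apply, LinearMap.BilinForm.apply_dualBasis_left,
      LinearMap.BilinForm.apply_dualBasis_right hn hω, hkl.ne]
  · rintro ⟨⟨i, j⟩, hij⟩ - hne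
    change i < j at hij
    have hne' : ¬ (k = i ∧ l = j) := by rintro ⟨rfl, rfl⟩; exact hne rfl
    have hswap : ¬ (k = j ∧ l = i) := by rintro ⟨rfl, rfl⟩; exact lt_asymm hij hkl
    simp only [LinearMap.smul_apply, map_smul, wedgeEnd_apply, map_add, LinearMap.add_apply,
      LinearMap.BilinForm.apply_dualBasis_left, smul_eq_mul,
      LinearMap.BilinForm.apply_dualBasis_right hn hω, ← ite_and, ite_mul, one_mul, zero_mul,
      if_neg hne', if_neg hswap, add_zero, mul_zero]
  · exact fun h => absurd (Finset.mem_univ _) h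

end Basis

variable [FiniteDimensional (ZMod 2) W]

theorem exists_isDiagonal (hω : ω.IsSymm) (hn : ω.Nondegenerate) {X : Module.End (ZMod 2) W}
    (hX : X ∈ ω.selfAdjointSubmodule) : ∃ w, IsDiagonal ω X w := by
  have hadd : ∀ x y, ω (X (x + y)) (x + y) = ω (X x) x + ω (X y) y := fun x y => by
    simp only [map_add, LinearMap.add_apply]
    rw [mem_selfAdjointSubmodule_iff_apply.1 hX x y, hω.eq x (X y)]
    linear_combination CharTwo.add_self_eq_zero (ω (X y) x)
  let f : W →ₗ[ZMod 2] ZMod 2 :=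
    (AddMonoidHom.mk' (fun x => ω (X x) x) hadd).toZModLinearMap 2
  exact ⟨(ω.toDual hn).symm f, fun x =>
    (LinearMap.BilinForm.apply_toDual_symm_apply (hB := hn) f x).symm.trans (hω.eq _ _)⟩

theorem alternatingEnd_le_of_wedgeEnd_mem (hω : ω.IsSymm) (hn : ω.Nondegenerate)
    {M : Submodule (ZMod 2) (Module.End (ZMod 2) W)} (h : ∀ x y, wedgeEnd ω x y ∈ M) :
    alternatingEnd ω ≤ M := by
  intro X hX
  let b := Module.finBasis (ZMod 2) W
  have hsum : ofUpperCoeffs b hn (upperCoeffs b ω X) = X :=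
    eq_of_upperCoeffs_eq hω hn (ofUpperCoeffs_mem hn (wedgeEnd_mem_alternatingEnd hω) _) hX
      (upperCoeffs_ofUpperCoeffs hω hn _)
  exact hsum ▸ ofUpperCoeffs_mem hn h _

theorem selfAdjointSubmodule_le_of_wedgeEnd_mem (hω : ω.IsSymm) (hn : ω.Nondegenerate)
    {M : Submodule (ZMod 2) (Module.End (ZMod 2) W)} (hwedge : ∀ x y, wedgeEnd ω x y ∈ M)
    (hsquare : ∀ x, squareEnd ω x ∈ M) : ω.selfAdjointSubmodule ≤ M := by
  intro X hX
  obtain ⟨w, hw⟩ := exists_isDiagonal hω hn hX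
  exact (M.add_mem_iff_left (hsquare w)).1
    (alternatingEnd_le_of_wedgeEnd_mem hω hn hwedge (hw.add_squareEnd_mem hω))

theorem card_alternatingEnd (hω : ω.IsSymm) (hn : ω.Nondegenerate) :
    Nat.card (alternatingEnd ω) = 2 ^ (Module.finrank (ZMod 2) W).choose 2 := by
  let b := Module.finBasis (ZMod 2) W
  have hbij : Function.Bijective fun X : alternatingEnd ω => upperCoeffs b ω X.1 :=
    ⟨fun X Y h => Subtype.ext (eq_of_upperCoeffs_eq hω hn X.2 Y.2 h), fun f =>
      ⟨⟨ofUpperCoeffs b hn f, ofUpperCoeffs_mem hn (wedgeEnd_mem_alternatingEnd hω) f⟩,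
        upperCoeffs_ofUpperCoeffs hω hn f⟩⟩
  rw [Nat.card_eq_of_bijective _ hbij, Nat.card_fun, Nat.card_zmod, Nat.card_eq_fintype_card,
    Fintype.card_subtype, Fintype.card_product_filter_lt, Fintype.card_fin]

end AlternatingEndomorphisms

/-! ### Stable spaces of endomorphisms of the standard representation -/

section StandardRepresentation

variable {d : ℕ}

local notation "⟪" x ", " y "⟫" => stdForm _ x y

/-- The vector `e_i + e_j` of `W_0`. -/
def pairSumZero (i j : Fin d) : sumZero d :=
  ⟨Pi.single i 1 + Pi.single j 1, by
    change ∑ k, (Pi.single i 1 + Pi.single j 1 : Fin d → ZMod 2) k = 0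
    simp only [Pi.add_apply, Finset.sum_add_distrib, Finset.sum_pi_single', Finset.mem_univ,
      if_true]
    rfl⟩

/-- The class `v_ij` of `e_i + e_j` in the standard representation. -/
def pairVec (i j : Fin d) : StdSpace d := (onesLine d).mkQ (pairSumZero i j)

theorem pairSumZero_apply (i j k : Fin d) :
    (pairSumZero i j).1 k = (if k = i then 1 else 0) + if k = j then 1 else 0 := by
  simp only [pairSumZero, Pi.add_apply, Pi.single_apply]

theorem pairVec_comm (i j : Fin d) : pairVec i j = pairVec j i :=
  congrArg (onesLine d).mkQ (Subtype.ext (add_comm (Pi.single i 1 : Fin d → ZMod 2) _))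

theorem pairVec_self (i : Fin d) : pairVec i i = 0 := by
  rw [pairVec, ← (onesLine d).mkQ.map_zero]
  exact congrArg (onesLine d).mkQ
    (Subtype.ext (ZModModule.add_self (Pi.single i 1 : Fin d → ZMod 2)))

theorem pairVec_add (i j k : Fin d) : pairVec i j + pairVec j k = pairVec i k := by
  rw [pairVec, pairVec, ← map_add]
  exact congrArg (onesLine d).mkQ (Subtype.ext (ZModModule.add_add_add_cancel _ _ _))

theorem pairVec_add_common (i j k : Fin d) : pairVec i j + pairVec i k = pairVec j k := by
  rw [pairVec_comm i j, pairVec_add]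

theorem stdForm_mk_pairVec (y : sumZero d) (i j : Fin d) :
    ⟪(onesLine d).mkQ y, pairVec i j⟫ = y.1 i + y.1 j := by
  rw [pairVec, stdForm_mk]
  simp [pairSumZero_apply, mul_add, Finset.sum_add_distrib]

theorem stdForm_isSymm : LinearMap.BilinForm.IsSymm (stdForm d) := ⟨fun x y => by
  obtain ⟨v, rfl⟩ := (onesLine d).mkQ_surjective x
  obtain ⟨w, rfl⟩ := (onesLine d).mkQ_surjective y
  exact ((stdForm_mk v w).trans (Finset.sum_congr rfl fun i _ => mul_comm (v.1 i) (w.1 i))).trans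
    (stdForm_mk w v).symm⟩

theorem stdForm_isAlt : LinearMap.BilinForm.IsAlt (stdForm d) := fun x => by
  obtain ⟨v, rfl⟩ := (onesLine d).mkQ_surjective x
  have hv : ∑ i, v.1 i = 0 := v.2
  rw [stdForm_mk, ← hv]
  exact Finset.sum_congr rfl fun i _ => zmod_two_mul_self _

theorem stdForm_comm (x y : StdSpace d) : ⟪x, y⟫ = ⟪y, x⟫ := stdForm_isSymm.eq x y

theorem stdForm_self (x : StdSpace d) : ⟪x, x⟫ = 0 := stdForm_isAlt x

theorem stdForm_pairVec (i j k l : Fin d) :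
    ⟪pairVec i j, pairVec k l⟫ =
      ((if k = i then 1 else 0) + if k = j then 1 else 0) +
        ((if l = i then 1 else 0) + if l = j then 1 else 0) := by
  rw [pairVec, stdForm_mk_pairVec, pairSumZero_apply, pairSumZero_apply]

theorem stdForm_pairVec_of_disjoint {i j k l : Fin d} (hik : i ≠ k) (hil : i ≠ l) (hjk : j ≠ k)
    (hjl : j ≠ l) : ⟪pairVec i j, pairVec k l⟫ = 0 := by
  simp [stdForm_pairVec, hik.symm, hil.symm, hjk.symm, hjl.symm]

theorem stdForm_pairVec_of_common {i j k : Fin d} (hij : i ≠ j) (hik : i ≠ k) (hjk : j ≠ k) :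
    ⟪pairVec i j, pairVec i k⟫ = 1 := by
  simp [stdForm_pairVec, hij, hik.symm, hjk.symm]

theorem permStd_pairVec (σ : Equiv.Perm (Fin d)) (i j : Fin d) :
    permStd σ (pairVec i j) = pairVec (σ i) (σ j) := by
  rw [pairVec, permStd_mk]
  refine congrArg (onesLine d).mkQ (Subtype.ext (funext fun k => ?_))
  change (pairSumZero i j).1 (σ⁻¹ k) = _
  simp only [pairSumZero_apply, Equiv.Perm.inv_eq_iff_eq]

theorem permStd_swap (i j : Fin d) (x : StdSpace d) :
    permStd (Equiv.swap i j) x = x + ⟪x, pairVec i j⟫ • pairVec i j := by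
  obtain ⟨v, rfl⟩ := (onesLine d).mkQ_surjective x
  rw [stdForm_mk_pairVec, permStd_mk, pairVec, ← map_smul, ← map_add]
  refine congrArg (onesLine d).mkQ (Subtype.ext (funext fun k => ?_))
  change v.1 ((Equiv.swap i j)⁻¹ k) = v.1 k + (v.1 i + v.1 j) * (pairSumZero i j).1 k
  rw [Equiv.swap_inv, pairSumZero_apply]
  by_cases hki : k = i <;> by_cases hkj : k = j
  · subst hki hkj
    simp [CharTwo.add_self_eq_zero]
  · subst hki
    simp [hkj, CharTwo.add_cancel_left]
  · subst hkj
    simp [hki, add_comm (v.1 i), CharTwo.add_cancel_left]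
  · simp [Equiv.swap_apply_of_ne_of_ne hki hkj, hki, hkj]

theorem permStd_inv_apply (σ : Equiv.Perm (Fin d)) (x : StdSpace d) :
    permStd σ⁻¹ (permStd σ x) = x := by
  rw [← permStd_mul, inv_mul_cancel, permStd_one]

theorem permStd_apply_inv (σ : Equiv.Perm (Fin d)) (x : StdSpace d) :
    permStd σ (permStd σ⁻¹ x) = x := by
  rw [← permStd_mul, mul_inv_cancel, permStd_one]

theorem stdForm_permStd_left (σ : Equiv.Perm (Fin d)) (x y : StdSpace d) :
    ⟪permStd σ x, y⟫ = ⟪x, permStd σ⁻¹ y⟫ := by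
  rw [← stdForm_permStd σ x, permStd_apply_inv]

theorem span_range_pairVec (a : Fin d) :
    Submodule.span (ZMod 2) (Set.range (pairVec a)) = ⊤ := by
  refine eq_top_iff.2 fun x _ => ?_
  obtain ⟨v, rfl⟩ := (onesLine d).mkQ_surjective x
  have hv : ∑ k, v.1 k = 0 := v.2
  have hsum : v = ∑ k, v.1 k • pairSumZero a k := by
    refine Subtype.ext (funext fun l => ?_)
    simp [pairSumZero_apply, mul_add, Finset.sum_add_distrib, hv]
  rw [hsum, map_sum]
  refine Submodule.sum_mem _ fun k _ => ?_
  rw [map_smul]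
  exact Submodule.smul_mem _ _ (Submodule.subset_span ⟨k, rfl⟩)

theorem mem_of_pairVec_mem {N : Submodule (ZMod 2) (StdSpace d)} (a : Fin d)
    (h : ∀ k, pairVec a k ∈ N) (x : StdSpace d) : x ∈ N :=
  Submodule.span_le.2 (Set.range_subset_iff.2 h) (span_range_pairVec a ▸ Submodule.mem_top)

theorem bilin_ext_pairVec {P : Type*} [AddCommGroup P] [Module (ZMod 2) P]
    {f f' : StdSpace d →ₗ[ZMod 2] StdSpace d →ₗ[ZMod 2] P} (a : Fin d)
    (h : ∀ k l, f (pairVec a k) (pairVec a l) = f' (pairVec a k) (pairVec a l)) : f = f' :=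
  LinearMap.ext_on_range (span_range_pairVec a) fun k =>
    LinearMap.ext_on_range (span_range_pairVec a) (h k)

theorem eq_zero_of_stdForm_pairVec (x : StdSpace d) (h : ∀ i j, ⟪x, pairVec i j⟫ = 0) :
    x = 0 := by
  obtain ⟨v, rfl⟩ := (onesLine d).mkQ_surjective x
  simp only [stdForm_mk_pairVec] at h
  rw [Submodule.mkQ_apply, Submodule.Quotient.mk_eq_zero, mem_onesLine]
  rcases isEmpty_or_nonempty (Fin d) with hd | ⟨⟨a⟩⟩
  · exact ⟨0, fun i => hd.elim i⟩
  · exact ⟨v.1 a, fun i => CharTwo.add_eq_zero.1 (h i a)⟩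

theorem stdForm_nondegenerate : LinearMap.BilinForm.Nondegenerate (stdForm d) :=
  (stdForm_isAlt.isRefl).nondegenerate_iff_separatingLeft.2 fun x h =>
    eq_zero_of_stdForm_pairVec x fun _ _ => h _

end StandardRepresentation

section PermStable

variable {d : ℕ}

local notation "⟪" x ", " y "⟫" => stdForm _ x y
local infixl:70 " ⋏ " => wedgeEnd (stdForm _)
local postfix:max "²" => squareEnd (stdForm _)

theorem exists_ne_four (hd : 5 ≤ d) (i j k l : Fin d) : ∃ m, i ≠ m ∧ j ≠ m ∧ k ≠ m ∧ l ≠ m := by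
  obtain ⟨m, hm⟩ : ∃ m, m ∉ ({i, j, k, l} : Finset (Fin d)) := by
    by_contra! h
    have hcard := Finset.card_le_four (a := i) (b := j) (c := k) (d := l)
    rw [Finset.eq_univ_of_forall h, Finset.card_univ, Fintype.card_fin] at hcard
    omega
  simp only [Finset.mem_insert, Finset.mem_singleton, not_or, eq_comm (a := m)] at hm
  exact ⟨m, hm⟩

theorem exists_perm_pair {i j i' j' : Fin d} (h : i ≠ j) (h' : i' ≠ j') :
    ∃ σ : Equiv.Perm (Fin d), σ i = i' ∧ σ j = j' := by
  obtain ⟨σ, hσ⟩ := Equiv.Perm.exists_extending_pair ![i, j] ![i', j']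
    (by simp [Function.Injective, Fin.forall_fin_two, h, h.symm])
    (by simp [Function.Injective, Fin.forall_fin_two, h', h'.symm])
  exact ⟨σ, hσ 0, hσ 1⟩

/-- Conjugation of endomorphisms by a permutation, `X ↦ σ X σ⁻¹`. -/
def permConj (σ : Equiv.Perm (Fin d)) :
    Module.End (ZMod 2) (StdSpace d) →ₗ[ZMod 2] Module.End (ZMod 2) (StdSpace d) :=
  LinearMap.mulLeftRight (ZMod 2) (permStd σ, permStd σ⁻¹)

theorem permConj_apply (σ : Equiv.Perm (Fin d)) (X : Module.End (ZMod 2) (StdSpace d))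
    (x : StdSpace d) : permConj σ X x = permStd σ (X (permStd σ⁻¹ x)) := rfl

theorem permConj_squareEnd (σ : Equiv.Perm (Fin d)) (x : StdSpace d) :
    permConj σ x² = (permStd σ x)² := by
  refine LinearMap.ext fun y => ?_
  rw [permConj_apply, squareEnd_apply, squareEnd_apply, map_smul, stdForm_permStd_left, inv_inv]

theorem permConj_wedgeEnd (σ : Equiv.Perm (Fin d)) (x y : StdSpace d) :
    permConj σ (x ⋏ y) = permStd σ x ⋏ permStd σ y := by
  refine LinearMap.ext fun z => ?_
  rw [permConj_apply, wedgeEnd_apply, wedgeEnd_apply, map_add, map_smul, map_smul,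
    stdForm_permStd_left, stdForm_permStd_left, inv_inv]

theorem add_permConj_swap {X : Module.End (ZMod 2) (StdSpace d)}
    (hX : X ∈ (stdForm d).selfAdjointSubmodule) (i j : Fin d) :
    X + permConj (Equiv.swap i j) X = pairVec i j ⋏ X (pairVec i j) +
      ⟪X (pairVec i j), pairVec i j⟫ • (pairVec i j)² := by
  refine LinearMap.ext fun y => ?_
  rw [LinearMap.add_apply, permConj_apply, Equiv.swap_inv, permStd_swap, permStd_swap]
  simp only [LinearMap.add_apply, LinearMap.smul_apply, wedgeEnd_apply, squareEnd_apply, map_add,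
    map_smul, smul_eq_mul, add_smul, mul_smul]
  rw [mem_selfAdjointSubmodule_iff_apply.1 hX y]
  linear_combination (norm := module) ZModModule.add_self (X y)

/-- Stability of a space of endomorphisms under conjugation by permutations. -/
def PermStable (M : Submodule (ZMod 2) (Module.End (ZMod 2) (StdSpace d))) : Prop :=
  ∀ σ, ∀ X ∈ M, permConj σ X ∈ M

/-- The condition on `M` to contain `v_ij ∧ v_kl` for all disjoint pairs `{i, j}`, `{k, l}`. -/
def ContainsDisjoint (M : Submodule (ZMod 2) (Module.End (ZMod 2) (StdSpace d))) : Prop :=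
  ∀ i j k l : Fin d, i ≠ k → i ≠ l → j ≠ k → j ≠ l → pairVec i j ⋏ pairVec k l ∈ M

variable {M : Submodule (ZMod 2) (Module.End (ZMod 2) (StdSpace d))} {Q : Type*} [AddCommGroup Q]
  [Module (ZMod 2) Q] {q : Module.End (ZMod 2) (StdSpace d) →ₗ[ZMod 2] Q}

theorem PermStable.map_permConj_eq (hq : PermStable (LinearMap.ker q)) (σ : Equiv.Perm (Fin d))
    {X Y : Module.End (ZMod 2) (StdSpace d)} (h : q X = q Y) :
    q (permConj σ X) = q (permConj σ Y) := by
  rw [← LinearMap.sub_mem_ker_iff] at h ⊢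
  rw [← map_sub]
  exact hq σ _ h

theorem PermStable.squareEnd_pairVec_mem (hM : PermStable M) {i j : Fin d} (hij : i ≠ j)
    (h : (pairVec i j)² ∈ M) (k l : Fin d) : (pairVec k l)² ∈ M := by
  rcases eq_or_ne k l with rfl | hkl
  · rw [pairVec_self, squareEnd_zero]
    exact M.zero_mem
  · obtain ⟨σ, rfl, rfl⟩ := exists_perm_pair hij hkl
    rw [← permStd_pairVec, ← permConj_squareEnd]
    exact hM σ _ h

theorem wedgeEnd_mem_of_pairVec (a : Fin d) (h : ∀ k l, pairVec a k ⋏ pairVec a l ∈ M)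
    (x y : StdSpace d) : x ⋏ y ∈ M := by
  have hzero : (wedgeEnd (stdForm d)).compr₂ M.mkQ = 0 :=
    bilin_ext_pairVec a fun k l => (Submodule.Quotient.mk_eq_zero M).2 (h k l)
  exact (Submodule.Quotient.mk_eq_zero M).1 (LinearMap.congr_fun₂ hzero x y)

theorem PermStable.selfAdjointSubmodule_le (hM : PermStable M) {i j : Fin d} (hij : i ≠ j)
    (h : (pairVec i j)² ∈ M) : (stdForm d).selfAdjointSubmodule ≤ M := by
  have hpair := hM.squareEnd_pairVec_mem hij h
  have hwedge : ∀ x y, x ⋏ y ∈ M := wedgeEnd_mem_of_pairVec i fun k l => by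
    have hsq := hpair k l
    rw [← pairVec_add_common i, squareEnd_add] at hsq
    exact (M.add_mem_iff_right (M.add_mem (hpair i k) (hpair i l))).1 hsq
  let N : Submodule (ZMod 2) (StdSpace d) := AddSubgroup.toZModSubmodule 2
    { carrier := {x | x² ∈ M}
      add_mem' := fun {x y} hx hy => by
        rw [Set.mem_ofPred_eq, squareEnd_add]
        exact M.add_mem (M.add_mem hx hy) (hwedge x y)
      zero_mem' := by
        rw [Set.mem_ofPred_eq, squareEnd_zero]
        exact M.zero_mem
      neg_mem' := fun {x} hx => by rwa [ZModModule.neg_eq_self] }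
  exact selfAdjointSubmodule_le_of_wedgeEnd_mem stdForm_isSymm stdForm_nondegenerate hwedge
    (mem_of_pairVec_mem (N := N) i (hpair i))

theorem PermStable.selfAdjointSubmodule_le_of_not_le (hM : PermStable M)
    (hle : M ≤ (stdForm d).selfAdjointSubmodule) (halt : alternatingEnd (stdForm d) ≤ M)
    (hnot : ¬ M ≤ alternatingEnd (stdForm d)) : (stdForm d).selfAdjointSubmodule ≤ M := by
  obtain ⟨X, hXM, hX⟩ := SetLike.not_le_iff_exists.1 hnot
  obtain ⟨w, hw⟩ := exists_isDiagonal stdForm_isSymm stdForm_nondegenerate (hle hXM)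
  have hsq : w² ∈ M := (M.add_mem_iff_right hXM).1 (halt (hw.add_squareEnd_mem stdForm_isSymm))
  have hw0 : w ≠ 0 := by
    rintro rfl
    exact hX (isDiagonal_zero_iff.1 hw)
  obtain ⟨k, l, hkl⟩ : ∃ k l, ⟪w, pairVec k l⟫ ≠ 0 := by
    by_contra! h
    exact hw0 (eq_zero_of_stdForm_pairVec w h)
  have hne : k ≠ l := by
    rintro rfl
    exact hkl (by rw [pairVec_self, map_zero])
  refine hM.selfAdjointSubmodule_le hne ?_
  -- The transposition moves `w` to `w + v_kl`, and `(w + v_kl)² = w² + v_kl² + w ∧ v_kl`.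
  have hconj := hM (Equiv.swap k l) _ hsq
  rw [permConj_squareEnd, permStd_swap, (zmod_two_eq_zero_or_one _).resolve_left hkl, one_smul,
    squareEnd_add] at hconj
  exact (M.add_mem_iff_right hsq).1
    ((M.add_mem_iff_left (halt (wedgeEnd_mem_alternatingEnd stdForm_isSymm _ _))).1 hconj)

theorem PermStable.containsDisjoint (hM : PermStable M) {i j k l : Fin d}
    (hij : i ≠ j) (hkl : k ≠ l) (hik : i ≠ k) (hil : i ≠ l) (hjk : j ≠ k) (hjl : j ≠ l)
    (h : pairVec i j ⋏ pairVec k l ∈ M) : ContainsDisjoint M := by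
  intro i' j' k' l' hik' hil' hjk' hjl'
  rcases eq_or_ne i' j' with rfl | hij'
  · rw [pairVec_self, map_zero, LinearMap.zero_apply]
    exact M.zero_mem
  rcases eq_or_ne k' l' with rfl | hkl'
  · rw [pairVec_self, map_zero]
    exact M.zero_mem
  obtain ⟨σ, hσ⟩ := Equiv.Perm.exists_extending_pair ![i, j, k, l] ![i', j', k', l']
    (by simp [Function.Injective, Fin.forall_fin_succ, *, Ne.symm, ne_comm])
    (by simp [Function.Injective, Fin.forall_fin_succ, *, Ne.symm, ne_comm])
  have hconj := hM σ _ h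
  rwa [permConj_wedgeEnd, permStd_pairVec, permStd_pairVec, show σ i = i' from hσ 0,
    show σ j = j' from hσ 1, show σ k = k' from hσ 2, show σ l = l' from hσ 3] at hconj

theorem ContainsDisjoint.map_wedgeEnd_pairVec (hU : ContainsDisjoint (LinearMap.ker q))
    {a b c k l : Fin d} (hab : a ≠ b) (hac : a ≠ c) (hbc : b ≠ c) (hak : a ≠ k) (hal : a ≠ l)
    (hkl : k ≠ l) :
    q (pairVec a k ⋏ pairVec a l) = q (pairVec a b ⋏ pairVec a c) := by
  have hright : ∀ {k m n}, a ≠ m → a ≠ n → k ≠ m → k ≠ n →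
      q (pairVec a k ⋏ pairVec a m) = q (pairVec a k ⋏ pairVec a n) := by
    intro k m n ham han hkm hkn
    rw [← LinearMap.sub_mem_ker_iff, ZModModule.sub_eq_add, ← map_add, pairVec_add_common]
    exact hU _ _ _ _ ham han hkm hkn
  rcases eq_or_ne l b with rfl | hlb
  · rw [wedgeEnd_comm]
    exact hright hak hac hkl.symm hbc
  · rw [wedgeEnd_comm, hright hak hab hkl.symm hlb, wedgeEnd_comm]
    exact hright hal hac hlb.symm hbc

theorem ContainsDisjoint.map_wedgeEnd (hU : ContainsDisjoint (LinearMap.ker q)) {a b c : Fin d}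
    (hab : a ≠ b) (hac : a ≠ c) (hbc : b ≠ c) (x y : StdSpace d) :
    q (x ⋏ y) = ⟪x, y⟫ • q (pairVec a b ⋏ pairVec a c) := by
  have hext : (wedgeEnd (stdForm d)).compr₂ q =
      (stdForm d).compr₂ (LinearMap.toSpanSingleton (ZMod 2) _
        (q (pairVec a b ⋏ pairVec a c))) := by
    refine bilin_ext_pairVec a fun k l => ?_
    simp only [LinearMap.compr₂_apply, LinearMap.toSpanSingleton_apply]
    rcases eq_or_ne k l with rfl | hkl
    · rw [wedgeEnd_self, stdForm_self, zero_smul, map_zero]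
    rcases eq_or_ne a k with rfl | hak
    · simp only [pairVec_self, map_zero, LinearMap.zero_apply, zero_smul]
    rcases eq_or_ne a l with rfl | hal
    · simp only [pairVec_self, map_zero, zero_smul]
    rw [stdForm_pairVec_of_common hak hal hkl, one_smul,
      hU.map_wedgeEnd_pairVec hab hac hbc hak hal hkl]
  exact LinearMap.congr_fun₂ hext x y

theorem ContainsDisjoint.alternatingEnd_le (hU : ContainsDisjoint (LinearMap.ker q))
    {a b c : Fin d} (hab : a ≠ b) (hac : a ≠ c) (hbc : b ≠ c)
    (h : q (pairVec a b ⋏ pairVec a c) = 0) : alternatingEnd (stdForm d) ≤ LinearMap.ker q := by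
  refine alternatingEnd_le_of_wedgeEnd_mem stdForm_isSymm stdForm_nondegenerate fun x y => ?_
  rw [LinearMap.mem_ker, hU.map_wedgeEnd hab hac hbc, h, smul_zero]

end PermStable

section Generation

variable {d : ℕ}

local notation "⟪" x ", " y "⟫" => stdForm _ x y
local infixl:70 " ⋏ " => wedgeEnd (stdForm _)
local postfix:max "²" => squareEnd (stdForm _)

theorem stdForm_pairVec_eq_add (z : StdSpace d) (k l n : Fin d) :
    ⟪z, pairVec k l⟫ = ⟪z, pairVec n k⟫ + ⟪z, pairVec n l⟫ := by
  rw [← map_add, pairVec_add_common]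

theorem eq_zero_of_stdForm_pairVec_left (x : StdSpace d) (m : Fin d)
    (h : ∀ k, ⟪x, pairVec m k⟫ = 0) : x = 0 :=
  eq_zero_of_stdForm_pairVec x fun k l => by rw [stdForm_pairVec_eq_add x k l m, h, h, add_zero]

theorem eq_zero_or_eq_pairVec (hd : 5 ≤ d) {i j : Fin d} (hij : i ≠ j) {z : StdSpace d}
    (hz : ∀ k l, i ≠ k → i ≠ l → j ≠ k → j ≠ l → ⟪z, pairVec k l⟫ = 0)
    (h : ⟪z, pairVec i j⟫ = 0) : z = 0 ∨ z = pairVec i j := by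
  obtain ⟨m, him, hjm, -, -⟩ := exists_ne_four hd i j i j
  have hzero : ∀ y : StdSpace d, (∀ k, i ≠ k → j ≠ k → ⟪y, pairVec m k⟫ = 0) →
      ⟪y, pairVec i j⟫ = 0 → ⟪y, pairVec m i⟫ = 0 → y = 0 := by
    intro y hy hij hi
    refine eq_zero_of_stdForm_pairVec_left y m fun k => ?_
    rcases eq_or_ne i k with rfl | hik
    · exact hi
    rcases eq_or_ne j k with rfl | hjk
    · rw [stdForm_pairVec_eq_add y m j i, hij, pairVec_comm, hi, add_zero]
    · exact hy k hik hjk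
  have hzm : ∀ k, i ≠ k → j ≠ k → ⟪z, pairVec m k⟫ = 0 := fun k hik hjk =>
    hz m k him hik hjm hjk
  rcases zmod_two_eq_zero_or_one ⟪z, pairVec m i⟫ with h0 | h1
  · exact Or.inl (hzero z hzm h h0)
  · refine Or.inr (sub_eq_zero.1 (hzero _ (fun k hik hjk => ?_) ?_ ?_))
    · rw [LinearMap.map_sub₂, hzm k hik hjk, stdForm_pairVec_of_disjoint him hik hjm hjk, sub_zero]
    · rw [LinearMap.map_sub₂, h, stdForm_self, sub_zero]
    · rw [LinearMap.map_sub₂, h1, pairVec_comm m i, stdForm_pairVec_of_common hij him hjm, sub_self]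

variable {M : Submodule (ZMod 2) (Module.End (ZMod 2) (StdSpace d))} {Q : Type*} [AddCommGroup Q]
  [Module (ZMod 2) Q] {q : Module.End (ZMod 2) (StdSpace d) →ₗ[ZMod 2] Q}

theorem PermStable.wedgeEnd_apply_mem (hM : PermStable M) {X : Module.End (ZMod 2) (StdSpace d)}
    (hX : X ∈ M) (hself : X ∈ (stdForm d).selfAdjointSubmodule) (i j : Fin d) :
    pairVec i j ⋏ X (pairVec i j) + ⟪X (pairVec i j), pairVec i j⟫ • (pairVec i j)² ∈ M :=
  add_permConj_swap hself i j ▸ M.add_mem hX (hM _ X hX)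

theorem PermStable.alternatingEnd_le_of_containsDisjoint (hd : 5 ≤ d)
    (hq : PermStable (LinearMap.ker q)) (hU : ContainsDisjoint (LinearMap.ker q)) {i j : Fin d}
    (hij : i ≠ j) (z : StdSpace d)
    (h : q (pairVec i j ⋏ z + (1 + ⟪z, pairVec i j⟫) • (pairVec i j)²) = 0) :
    alternatingEnd (stdForm d) ≤ LinearMap.ker q := by
  obtain ⟨k, hik, hjk, -, -⟩ := exists_ne_four hd i j i j
  rw [map_add, map_smul, hU.map_wedgeEnd hij hik hjk, stdForm_comm] at h
  rcases zmod_two_eq_zero_or_one ⟪z, pairVec i j⟫ with h0 | h1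
  · rw [h0, zero_smul, zero_add, add_zero, one_smul] at h
    exact (alternatingEnd_le_selfAdjointSubmodule stdForm_isSymm).trans
      (hq.selfAdjointSubmodule_le hij h)
  · rw [h1, ZModModule.add_self, zero_smul, add_zero, one_smul] at h
    exact hU.alternatingEnd_le hij hik hjk h

theorem PermStable.containsDisjoint_of_stdForm_eq_one (hM : PermStable M) {i j k l : Fin d}
    (hij : i ≠ j) (hik : i ≠ k) (hil : i ≠ l) (hjk : j ≠ k) (hjl : j ≠ l) {z : StdSpace d}
    (c : ZMod 2) (h : pairVec i j ⋏ z + c • (pairVec i j)² ∈ M) (hz : ⟪z, pairVec k l⟫ = 1) :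
    ContainsDisjoint M := by
  have hkl : k ≠ l := by
    rintro rfl
    rw [pairVec_self, map_zero] at hz
    exact zero_ne_one hz
  have hself : pairVec i j ⋏ z + c • (pairVec i j)² ∈ (stdForm d).selfAdjointSubmodule :=
    Submodule.add_mem _ (alternatingEnd_le_selfAdjointSubmodule stdForm_isSymm
      (wedgeEnd_mem_alternatingEnd stdForm_isSymm _ _))
      (Submodule.smul_mem _ _ (squareEnd_mem_selfAdjointSubmodule stdForm_isSymm _))
  have hdisj : ⟪pairVec k l, pairVec i j⟫ = 0 :=
    stdForm_pairVec_of_disjoint hik.symm hjk.symm hil.symm hjl.symm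
  have hmem := hM.wedgeEnd_apply_mem h hself k l
  rw [LinearMap.add_apply, LinearMap.smul_apply, wedgeEnd_apply, squareEnd_apply, hdisj,
    stdForm_comm _ z, hz, zero_smul, zero_smul, smul_zero, one_smul, zero_add, add_zero,
    stdForm_comm (pairVec i j), hdisj, zero_smul, add_zero] at hmem
  exact hM.containsDisjoint hkl hij hik.symm hjk.symm hil.symm hjl.symm hmem

theorem PermStable.containsDisjoint_of_wedgeEnd_mem (hd : 5 ≤ d) (hM : PermStable M)
    {i j : Fin d} (hij : i ≠ j) {z : StdSpace d} (h : pairVec i j ⋏ z ∈ M)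
    (hz : ∀ k l, i ≠ k → i ≠ l → j ≠ k → j ≠ l → ⟪z, pairVec k l⟫ = 0)
    (hzij : ⟪z, pairVec i j⟫ = 1) : ContainsDisjoint M := by
  have hself : ∀ x y : StdSpace d, x ⋏ y ∈ (stdForm d).selfAdjointSubmodule := fun x y =>
    alternatingEnd_le_selfAdjointSubmodule stdForm_isSymm
      (wedgeEnd_mem_alternatingEnd stdForm_isSymm x y)
  obtain ⟨k, hik, hjk, -, -⟩ := exists_ne_four hd i j i j
  obtain ⟨l, hil, hjl, hkl, -⟩ := exists_ne_four hd i j k k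
  set c := ⟪z, pairVec j k⟫ with hc
  have hjk_mem : pairVec j k ⋏ (z + c • pairVec i j) ∈ M := by
    have hmem := hM.wedgeEnd_apply_mem h (hself _ _) j k
    have hone : ⟪pairVec i j, pairVec j k⟫ = 1 := by
      rw [pairVec_comm i j, stdForm_pairVec_of_common hij.symm hjk hik]
    rw [wedgeEnd_apply, stdForm_comm _ z, ← hc, stdForm_comm, hone, one_smul, LinearMap.map_add₂,
      LinearMap.map_smul₂, hone, ← hc, smul_eq_mul, mul_one, ZModModule.add_self, zero_smul,
      add_zero] at hmem
    exact hmem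
  have hzil : ⟪z, pairVec i l⟫ = 1 + c := by
    rw [stdForm_pairVec_eq_add z i l j, pairVec_comm j i, hzij,
      stdForm_pairVec_eq_add z j l k, pairVec_comm k j, ← hc, hz k l hik hil hjk hjl, add_zero]
  have hil_mem := hM.wedgeEnd_apply_mem hjk_mem (hself _ _) i l
  have hdisj : ⟪pairVec j k, pairVec i l⟫ = 0 :=
    stdForm_pairVec_of_disjoint hij.symm hjl hik.symm hkl
  have hone : ⟪z + c • pairVec i j, pairVec i l⟫ = 1 := by
    rw [LinearMap.map_add₂, LinearMap.map_smul₂, hzil,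
      stdForm_pairVec_of_common hij hil hjl, smul_eq_mul, mul_one, add_assoc, ZModModule.add_self,
      add_zero]
  rw [wedgeEnd_apply, stdForm_comm, hdisj, stdForm_comm, hone, zero_smul, zero_add, one_smul,
    hdisj, zero_smul, add_zero] at hil_mem
  exact hM.containsDisjoint hil hjk hij hik hjl.symm hkl.symm hil_mem

theorem PermStable.alternatingEnd_le_of_square (hd : 5 ≤ d) (hq : PermStable (LinearMap.ker q))
    {i j : Fin d} (hij : i ≠ j) (z : StdSpace d)
    (h : q (pairVec i j ⋏ z + (1 + ⟪z, pairVec i j⟫) • (pairVec i j)²) = 0) :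
    alternatingEnd (stdForm d) ≤ LinearMap.ker q := by
  by_cases hex : ∃ k l, i ≠ k ∧ i ≠ l ∧ j ≠ k ∧ j ≠ l ∧ ⟪z, pairVec k l⟫ = 1
  · obtain ⟨k, l, hik, hil, hjk, hjl, hz⟩ := hex
    exact hq.alternatingEnd_le_of_containsDisjoint hd
      (hq.containsDisjoint_of_stdForm_eq_one hij hik hil hjk hjl _ h hz) hij z h
  have hz : ∀ k l, i ≠ k → i ≠ l → j ≠ k → j ≠ l → ⟪z, pairVec k l⟫ = 0 :=
    fun k l hik hil hjk hjl => (zmod_two_eq_zero_or_one _).resolve_right fun h1 =>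
      hex ⟨k, l, hik, hil, hjk, hjl, h1⟩
  rcases zmod_two_eq_zero_or_one ⟪z, pairVec i j⟫ with h0 | h1
  · have hsq : q (pairVec i j)² = 0 := by
      rcases eq_zero_or_eq_pairVec hd hij hz h0 with rfl | rfl
      · simpa only [map_zero, LinearMap.zero_apply, zero_add, add_zero, one_smul] using h
      · simpa only [wedgeEnd_self, stdForm_self, zero_add, add_zero, one_smul] using h
    exact (alternatingEnd_le_selfAdjointSubmodule stdForm_isSymm).trans
      (hq.selfAdjointSubmodule_le hij hsq)
  · refine hq.alternatingEnd_le_of_containsDisjoint hd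
      (hq.containsDisjoint_of_wedgeEnd_mem hd hij ?_ hz h1) hij z h
    rwa [h1, ZModModule.add_self, zero_smul, add_zero] at h

theorem PermStable.map_squareEnd_pairVec (hq : PermStable (LinearMap.ker q)) {o : Q}
    (ho : ∀ x y, ⟪x, y⟫ = 1 → q (x ⋏ y) = o) {i j k l m : Fin d} (hil : i ≠ l) (him : i ≠ m)
    (hjl : j ≠ l) (hjm : j ≠ m) (hkl : k ≠ l) (hkm : k ≠ m) (hlm : l ≠ m)
    (h : q (pairVec i j)² + q (pairVec k l)² = o) {a b : Fin d} (hab : a ≠ b) :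
    q (pairVec a b)² = o := by
  have hlm_one : ⟪pairVec k l, pairVec k m⟫ = 1 := stdForm_pairVec_of_common hkl hkm hlm
  have hkl_km : q (pairVec k l)² = q (pairVec k m)² := by
    rw [← ho _ _ hlm_one, ← map_add] at h
    have hconj := hq.map_permConj_eq (Equiv.swap l m) h
    rw [map_add (permConj _), permConj_squareEnd, permConj_squareEnd, permStd_pairVec,
      permStd_pairVec, Equiv.swap_apply_of_ne_of_ne hil him, Equiv.swap_apply_of_ne_of_ne hjl hjm,
      Equiv.swap_apply_of_ne_of_ne hkl hkm, Equiv.swap_apply_left, permConj_wedgeEnd,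
      ho _ _ ((stdForm_permStd _ _ _).trans hlm_one), ← ho _ _ hlm_one, ← h, map_add,
      map_add] at hconj
    exact (add_left_cancel hconj).symm
  have hlm_sq : q (pairVec l m)² = q (pairVec k l ⋏ pairVec k m) := by
    rw [← pairVec_add_common k l m, squareEnd_add, map_add, map_add, hkl_km, ZModModule.add_self,
      zero_add]
  obtain ⟨σ, rfl, rfl⟩ := exists_perm_pair hlm hab
  rw [← permStd_pairVec, ← permConj_squareEnd, hq.map_permConj_eq σ hlm_sq, permConj_wedgeEnd,
    ho _ _ ((stdForm_permStd _ _ _).trans hlm_one)]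

theorem PermStable.alternatingEnd_le_of_commutator (hd : 5 ≤ d)
    (hq : PermStable (LinearMap.ker q)) (hU : ContainsDisjoint (LinearMap.ker q))
    {i j k l : Fin d} (hij : i ≠ j) (hik : i ≠ k) (hil : i ≠ l)
    (hjk : j ≠ k) (hjl : j ≠ l) (hkl : k ≠ l) {w w' z z' : StdSpace d} (hw : ⟪w, w'⟫ = 1)
    (h : q (w ⋏ w' + (pairVec i j ⋏ z + ⟪z, pairVec i j⟫ • (pairVec i j)²) +
      (pairVec k l ⋏ z' + ⟪z', pairVec k l⟫ • (pairVec k l)²)) = 0) :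
    alternatingEnd (stdForm d) ≤ LinearMap.ker q := by
  obtain ⟨m, him, hjm, hkm, hlm⟩ := exists_ne_four hd i j k l
  set o := q (pairVec i j ⋏ pairVec i k)
  have hwedge : ∀ x y, q (x ⋏ y) = ⟪x, y⟫ • o := hU.map_wedgeEnd hij hik hjk
  have hsq_zero : ∀ {a b : Fin d}, a ≠ b → q (pairVec a b)² = 0 →
      alternatingEnd (stdForm d) ≤ LinearMap.ker q := fun hab h0 =>
    (alternatingEnd_le_selfAdjointSubmodule stdForm_isSymm).trans
      (hq.selfAdjointSubmodule_le hab h0)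
  simp only [map_add, map_smul, hwedge, hw, one_smul, stdForm_comm (pairVec i j) z,
    stdForm_comm (pairVec k l) z'] at h
  rcases zmod_two_eq_zero_or_one ⟪z, pairVec i j⟫ with hz | hz <;>
    rcases zmod_two_eq_zero_or_one ⟪z', pairVec k l⟫ with hz' | hz' <;>
    simp only [hz, hz', zero_smul, one_smul, add_zero, ← add_assoc, ZModModule.add_self,
      zero_add] at h
  · exact hU.alternatingEnd_le hij hik hjk h
  · exact hsq_zero hkl h
  · exact hsq_zero hij h
  · rw [add_right_comm, ← ZModModule.sub_eq_add, sub_eq_zero] at h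
    have hsq : ∀ {a b : Fin d}, a ≠ b → q (pairVec a b)² = o :=
      hq.map_squareEnd_pairVec (fun x y hxy => by rw [hwedge, hxy, one_smul]) hil him hjl hjm hkl
        hkm hlm h
    rw [hsq hij, hsq hkl, ZModModule.add_self] at h
    exact hU.alternatingEnd_le hij hik hjk h.symm

end Generation

/-! ### Crossed homomorphisms into the standard representation -/

section Cohomology

variable {d : ℕ}

local notation "⟪" x ", " y "⟫" => stdForm _ x y
local infixl:70 " ⋏ " => wedgeEnd (stdForm _)

theorem stdForm_eq_zero_of_permStd_swap (hd : 5 ≤ d) {i j : Fin d} {x : StdSpace d}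
    (h : permStd (Equiv.swap i j) x = x) : ⟪x, pairVec i j⟫ = 0 := by
  rcases eq_or_ne i j with rfl | hij
  · rw [pairVec_self, map_zero]
  rw [permStd_swap, add_eq_left, smul_eq_zero] at h
  refine h.resolve_right fun h0 => ?_
  obtain ⟨k, hik, hjk, -, -⟩ := exists_ne_four hd i j i j
  have hone := stdForm_pairVec_of_common hij hik hjk
  rw [h0, map_zero, LinearMap.zero_apply] at hone
  exact zero_ne_one hone

/-- `R` is the graph of an `S_d`-equivariant linear map into the standard representation, defined
on a space of endomorphisms of it. -/
structure IsEquivariantGraph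
    (R : Submodule (ZMod 2) (Module.End (ZMod 2) (StdSpace d) × StdSpace d)) : Prop where
  permConj_mem : ∀ σ X y, (X, y) ∈ R → (permConj σ X, permStd σ y) ∈ R
  eq_zero_of_zero : ∀ y, (0, y) ∈ R → y = 0

variable {R : Submodule (ZMod 2) (Module.End (ZMod 2) (StdSpace d) × StdSpace d)}

theorem IsEquivariantGraph.unique (hR : IsEquivariantGraph R)
    {X : Module.End (ZMod 2) (StdSpace d)} {y y' : StdSpace d} (h : (X, y) ∈ R)
    (h' : (X, y') ∈ R) : y = y' := by
  refine sub_eq_zero.1 (hR.eq_zero_of_zero _ ?_)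
  rw [← sub_self X, ← Prod.mk_sub_mk]
  exact R.sub_mem h h'

theorem IsEquivariantGraph.stdForm_pairVec_eq_zero (hd : 5 ≤ d) (hR : IsEquivariantGraph R)
    {i j k : Fin d} (hik : i ≠ k) (hjk : j ≠ k) {y : StdSpace d}
    (hy : (pairVec i j ⋏ pairVec i k, y) ∈ R) : ⟪y, pairVec i j⟫ = 0 := by
  refine stdForm_eq_zero_of_permStd_swap hd (hR.unique ?_ hy)
  have hswap : permConj (Equiv.swap i j) (pairVec i j ⋏ pairVec i k) =
      pairVec i j ⋏ pairVec i k := by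
    rw [permConj_wedgeEnd, permStd_pairVec, permStd_pairVec, Equiv.swap_apply_left,
      Equiv.swap_apply_right, Equiv.swap_apply_of_ne_of_ne hik.symm hjk.symm,
      ← pairVec_add_common i j k, map_add, pairVec_comm j i, wedgeEnd_self, zero_add]
  rw [← hswap]
  exact hR.permConj_mem _ _ _ hy

theorem wedgeEnd_pairVec_add_eq_zero (i j k l : Fin d) :
    pairVec i j ⋏ pairVec i k + pairVec i j ⋏ pairVec i l + pairVec i l ⋏ pairVec i k +
      pairVec l j ⋏ pairVec l k = 0 := by
  rw [← pairVec_add_common i l j, ← pairVec_add_common i l k, map_add, map_add,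
    LinearMap.add_apply, LinearMap.add_apply, wedgeEnd_self]
  generalize pairVec i j ⋏ pairVec i k = a
  generalize pairVec i j ⋏ pairVec i l = b
  generalize pairVec i l ⋏ pairVec i k = c
  linear_combination (norm := module) ZModModule.add_self a + ZModModule.add_self b +
    ZModModule.add_self c

theorem IsEquivariantGraph.eq_zero_of_wedgeEnd_mem (hd : 5 ≤ d) (hR : IsEquivariantGraph R)
    {i j k : Fin d} (hij : i ≠ j) (hik : i ≠ k) (hjk : j ≠ k) {y : StdSpace d}
    (hy : (pairVec i j ⋏ pairVec i k, y) ∈ R) : y = 0 := by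
  have hj : ⟪y, pairVec i j⟫ = 0 := hR.stdForm_pairVec_eq_zero hd hik hjk hy
  have hk : ⟪y, pairVec i k⟫ = 0 :=
    hR.stdForm_pairVec_eq_zero hd hij hjk.symm (wedgeEnd_comm (pairVec i j) _ ▸ hy)
  refine eq_zero_of_stdForm_pairVec_left y i fun l => ?_
  rcases eq_or_ne j l with rfl | hjl
  · exact hj
  rcases eq_or_ne k l with rfl | hkl
  · exact hk
  rcases eq_or_ne i l with rfl | hil
  · rw [pairVec_self, map_zero]
  obtain ⟨m, him, hjm, hkm, hlm⟩ := exists_ne_four hd i j k l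
  have hkl_mem := hR.permConj_mem (Equiv.swap k l) _ _ hy
  have hjl_mem := hR.permConj_mem (Equiv.swap j l) _ _ hy
  have hil_mem := hR.permConj_mem (Equiv.swap i l) _ _ hy
  rw [permConj_wedgeEnd, permStd_pairVec, permStd_pairVec, permStd_swap]
    at hkl_mem hjl_mem hil_mem
  rw [Equiv.swap_apply_of_ne_of_ne hik hil, Equiv.swap_apply_of_ne_of_ne hjk hjl,
    Equiv.swap_apply_left, stdForm_pairVec_eq_add y k l i, hk, zero_add] at hkl_mem
  rw [Equiv.swap_apply_of_ne_of_ne hij hil, Equiv.swap_apply_of_ne_of_ne hjk.symm hkl,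
    Equiv.swap_apply_left, stdForm_pairVec_eq_add y j l i, hj, zero_add] at hjl_mem
  rw [Equiv.swap_apply_of_ne_of_ne hij.symm hjl, Equiv.swap_apply_of_ne_of_ne hik.symm hkl,
    Equiv.swap_apply_left] at hil_mem
  set b := ⟪y, pairVec i l⟫
  have hsum := R.add_mem (R.add_mem (R.add_mem hy hkl_mem) hjl_mem) hil_mem
  simp only [Prod.mk_add_mk, wedgeEnd_pairVec_add_eq_zero] at hsum
  have hzero := congrArg (fun x => ⟪x, pairVec l m⟫) (hR.eq_zero_of_zero _ hsum)
  rw [pairVec_comm k, pairVec_comm j, pairVec_comm i] at hzero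
  simp only [map_add, map_zero, map_smul, LinearMap.add_apply, LinearMap.zero_apply,
    LinearMap.smul_apply, smul_eq_mul, mul_one, stdForm_pairVec_of_common hkl.symm hlm hkm,
    stdForm_pairVec_of_common hjl.symm hlm hjm, stdForm_pairVec_of_common hil.symm hlm him]
    at hzero
  linear_combination hzero - 2 * ZModModule.add_self ⟪y, pairVec l m⟫ - ZModModule.add_self b

theorem IsEquivariantGraph.eq_zero (hd : 5 ≤ d) (hR : IsEquivariantGraph R)
    (htotal : ∀ X ∈ alternatingEnd (stdForm d), ∃ y, (X, y) ∈ R)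
    {X : Module.End (ZMod 2) (StdSpace d)} (hX : X ∈ alternatingEnd (stdForm d)) {y : StdSpace d}
    (hy : (X, y) ∈ R) : y = 0 := by
  refine hR.unique hy (alternatingEnd_le_of_wedgeEnd_mem stdForm_isSymm stdForm_nondegenerate
    (M := R.comap (LinearMap.inl _ _ _)) (wedgeEnd_mem_of_pairVec ⟨0, by omega⟩ fun k l => ?_) hX)
  generalize (⟨0, by omega⟩ : Fin d) = a
  rw [Submodule.mem_comap, LinearMap.inl_apply]
  rcases eq_or_ne k l with rfl | hkl
  · rw [wedgeEnd_self]
    exact R.zero_mem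
  rcases eq_or_ne a k with rfl | hak
  · rw [pairVec_self, map_zero]
    exact R.zero_mem
  rcases eq_or_ne a l with rfl | hal
  · rw [pairVec_self, map_zero]
    exact R.zero_mem
  obtain ⟨z, hz⟩ := htotal _
    (wedgeEnd_mem_alternatingEnd stdForm_isSymm (pairVec a k) (pairVec a l))
  rwa [hR.eq_zero_of_wedgeEnd_mem hd hak hal hkl hz] at hz

theorem exists_stdForm_pairVec_eq (hd : Odd d) (a : Fin d) (c : Fin d → ZMod 2) (ha : c a = 0) :
    ∃ x : StdSpace d, ∀ k, ⟪x, pairVec a k⟫ = c k := by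
  have hd' : (d : ZMod 2) = 1 := ZMod.natCast_eq_one_iff_odd.2 hd
  refine ⟨(onesLine d).mkQ ⟨fun k => c k + ∑ l, c l, ?_⟩, fun k => ?_⟩
  · change ∑ k, (c k + ∑ l, c l) = 0
    rw [Finset.sum_add_distrib, Finset.sum_const, Finset.card_univ, Fintype.card_fin,
      nsmul_eq_mul, hd', one_mul, ZModModule.add_self]
  · rw [stdForm_mk_pairVec]
    change c a + _ + (c k + _) = _
    rw [ha, zero_add, add_left_comm, ZModModule.add_self, add_zero]

section CrossedHom

variable {ψ : Equiv.Perm (Fin d) → StdSpace d}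
  (hψ : ∀ σ τ, ψ (σ * τ) = permStd τ⁻¹ (ψ σ) + ψ τ)
include hψ

theorem crossedHom_one : ψ 1 = 0 := by
  have hone := hψ 1 1
  rwa [one_mul, inv_one, permStd_one, left_eq_add] at hone

theorem crossedHom_swap (hd : 5 ≤ d) {i j : Fin d} (hij : i ≠ j) :
    ψ (Equiv.swap i j) = 0 ∨ ψ (Equiv.swap i j) = pairVec i j := by
  refine eq_zero_or_eq_pairVec hd hij (fun k l hik hil hjk hjl => ?_)
    (stdForm_eq_zero_of_permStd_swap hd ?_)
  · rcases eq_or_ne k l with rfl | hkl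
    · rw [pairVec_self, map_zero]
    obtain ⟨m, him, hjm, hkm, hlm⟩ := exists_ne_four hd i j k l
    have hcomm : Equiv.swap i j * Equiv.swap k l = Equiv.swap k l * Equiv.swap i j :=
      (Equiv.Perm.disjoint_swap_swap (by simp [hij, hik, hil, hjk, hjl, hkl])).commute.eq
    have h := congrArg (fun σ => ⟪ψ σ, pairVec k m⟫) hcomm
    simp only [hψ, Equiv.swap_inv, permStd_swap, map_add, map_smul, LinearMap.add_apply,
      LinearMap.smul_apply, smul_eq_mul, stdForm_pairVec_of_common hkl hkm hlm,
      stdForm_pairVec_of_disjoint hik him hjk hjm] at h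
    linear_combination h
  · have h := hψ (Equiv.swap i j) (Equiv.swap i j)
    rw [Equiv.swap_mul_self, crossedHom_one hψ, Equiv.swap_inv] at h
    rw [← sub_eq_zero, ZModModule.sub_eq_add, h]

theorem crossedHom_mul_eq {x : StdSpace d} {σ τ : Equiv.Perm (Fin d)}
    (hσ : ψ σ = permStd σ⁻¹ x + x) (hτ : ψ τ = permStd τ⁻¹ x + x) :
    ψ (σ * τ) = permStd (σ * τ)⁻¹ x + x := by
  rw [hψ, hσ, hτ, map_add, mul_inv_rev, permStd_mul, ZModModule.add_add_add_cancel]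

theorem crossedHom_eq_of_swap {x : StdSpace d} (a : Fin d)
    (hx : ∀ k, ψ (Equiv.swap a k) = permStd (Equiv.swap a k)⁻¹ x + x) (σ : Equiv.Perm (Fin d)) :
    ψ σ = permStd σ⁻¹ x + x := by
  refine Equiv.Perm.swap_induction_on σ ?_ fun σ i j hij h => crossedHom_mul_eq hψ ?_ h
  · rw [crossedHom_one hψ, inv_one, permStd_one, ZModModule.add_self]
  · rcases eq_or_ne a i with rfl | -
    · exact hx j
    rcases eq_or_ne a j with rfl | haj
    · exact Equiv.swap_comm a i ▸ hx i
    · rw [← Equiv.swap_mul_swap_mul_swap haj.symm hij.symm, Equiv.swap_comm j a]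
      exact crossedHom_mul_eq hψ (crossedHom_mul_eq hψ (hx i) (hx j)) (hx i)

theorem exists_of_crossedHom (hd : 5 ≤ d) (hodd : Odd d) :
    ∃ x, ∀ σ, ψ σ = permStd σ⁻¹ x + x := by
  let a : Fin d := ⟨0, by omega⟩
  have hstar : ∀ k, ∃ c : ZMod 2, (k = a → c = 0) ∧ ψ (Equiv.swap a k) = c • pairVec a k := by
    intro k
    rcases eq_or_ne a k with rfl | hak
    · exact ⟨0, fun _ => rfl, by rw [Equiv.swap_self, zero_smul]; exact crossedHom_one hψ⟩
    rcases crossedHom_swap hψ hd hak with h | h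
    · exact ⟨0, fun _ => rfl, by rw [h, zero_smul]⟩
    · exact ⟨1, fun hka => absurd hka.symm hak, by rw [h, one_smul]⟩
  choose c hca hc using hstar
  obtain ⟨x, hx⟩ := exists_stdForm_pairVec_eq hodd a c (hca a rfl)
  refine ⟨x, crossedHom_eq_of_swap hψ a fun k => ?_⟩
  rw [Equiv.swap_inv, permStd_swap, hx, add_right_comm, ZModModule.add_self, zero_add, hc]

end CrossedHom

end Cohomology

/-! ### Symbols and layers -/

section Reduction

variable {W : Type*} [AddCommGroup W] [Module (ZMod 2) W] {V : Type*} [AddCommGroup V]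
  [Module ℤ_[2] V] {B : V →ₗ[ℤ_[2]] V →ₗ[ℤ_[2]] ℤ_[2]} {e : Red V 2 ≃+ W}

theorem toZMod_eq_zero_iff {c : ℤ_[2]} : PadicInt.toZMod c = 0 ↔ (2 : ℤ_[2]) ∣ c := by
  rw [← RingHom.mem_ker, PadicInt.ker_toZMod, PadicInt.maximalIdeal_eq_span_p,
    Ideal.mem_span_singleton, Nat.cast_ofNat]

theorem reduction_two_smul (v : V) : (multiples V 2).mkQ ((2 : ℤ_[2]) • v) = 0 :=
  (Submodule.Quotient.mk_eq_zero _).2 ⟨v, by rw [LinearMap.lsmul_apply, Nat.cast_ofNat]⟩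

/-- Reduction modulo `2`, transported to `W` along an identification `e` of `V / 2V` with `W`. -/
noncomputable def redVec (e : Red V 2 ≃+ W) : V →ₛₗ[PadicInt.toZMod (p := 2)] W where
  toFun v := e ((multiples V 2).mkQ v)
  map_add' v w := by rw [map_add, map_add]
  map_smul' c v := by
    rcases zmod_two_eq_zero_or_one (PadicInt.toZMod c) with h | h
    · obtain ⟨b, rfl⟩ := toZMod_eq_zero_iff.1 h
      rw [h, zero_smul, mul_smul, reduction_two_smul, map_zero]
    · obtain ⟨b, hb⟩ : (2 : ℤ_[2]) ∣ c - 1 := by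
        rw [← toZMod_eq_zero_iff, map_sub, h, map_one, sub_self]
      rw [h, one_smul, sub_eq_iff_eq_add.1 hb, add_smul, mul_smul, one_smul, map_add,
        reduction_two_smul, zero_add]

theorem redVec_apply (v : V) : redVec e v = e ((multiples V 2).mkQ v) := rfl

theorem redVec_surjective : Function.Surjective (redVec e) :=
  e.surjective.comp (multiples V 2).mkQ_surjective

theorem redVec_eq_zero_iff {v : V} : redVec e v = 0 ↔ ∃ u, v = (2 : ℤ_[2]) • u := by
  rw [redVec_apply, map_eq_zero_iff e e.injective, Submodule.mkQ_apply,
    Submodule.Quotient.mk_eq_zero, mem_multiples]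
  simp only [Nat.cast_ofNat, eq_comm]

theorem redVec_two_smul (u : V) : redVec e ((2 : ℤ_[2]) • u) = 0 := redVec_eq_zero_iff.2 ⟨u, rfl⟩

theorem redVec_eq_iff {v w : V} : redVec e v = redVec e w ↔ ∃ u, v = w + (2 : ℤ_[2]) • u := by
  rw [← sub_eq_zero, ← map_sub, redVec_eq_zero_iff]
  simp only [sub_eq_iff_eq_add']

theorem redVec_two_pow_smul {n : ℕ} (hn : n ≠ 0) (v : V) :
    redVec e ((2 ^ n : ℤ_[2]) • v) = 0 := by
  obtain ⟨m, rfl⟩ := Nat.exists_eq_succ_of_ne_zero hn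
  rw [pow_succ', mul_smul, redVec_two_smul]

theorem two_pow_smul_injective [Module.Free ℤ_[2] V] (n : ℕ) :
    Function.Injective fun v : V => (2 ^ n : ℤ_[2]) • v :=
  smul_right_injective V (pow_ne_zero n two_ne_zero)

theorem mul_val_apply (a b : Sp B) (v : V) : (a * b).1 v = a.1 (b.1 v) := rfl

theorem val_inv_apply (a : Sp B) (v : V) : a.1 (a⁻¹.1 v) = v := LinearEquiv.apply_symm_apply a.1 v

theorem redSp_eq_iff {m : ℕ} {a b : Sp B} : redSp B m a = redSp B m b ↔ a⁻¹ * b ∈ Gam B m := by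
  rw [Gam, MonoidHom.mem_ker, map_mul, map_inv, inv_mul_eq_one]

theorem mem_Gam_iff {n : ℕ} {a : Sp B} :
    a ∈ Gam B (2 ^ n) ↔ ∀ v, ∃ w, a.1 v = v + (2 ^ n : ℤ_[2]) • w := by
  have hmk : ∀ v : V, redMap a.1 (2 ^ n) ((multiples V (2 ^ n)).mkQ v) =
      (multiples V (2 ^ n)).mkQ v ↔ ∃ w, a.1 v = v + (2 ^ n : ℤ_[2]) • w := by
    intro v
    rw [redMap_mk, ← sub_eq_zero, ← map_sub, Submodule.mkQ_apply, Submodule.Quotient.mk_eq_zero,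
      mem_multiples]
    simp only [Nat.cast_pow, Nat.cast_ofNat, eq_sub_iff_add_eq', eq_comm]
  rw [Gam, MonoidHom.mem_ker, Subtype.ext_iff, LinearEquiv.ext_iff,
    (multiples V (2 ^ n)).mkQ_surjective.forall]
  exact forall_congr' hmk

theorem Gam_antitone : Antitone fun n : ℕ => Gam B (2 ^ n) := by
  intro m n h a ha
  rw [mem_Gam_iff] at ha ⊢
  intro v
  obtain ⟨w, hw⟩ := ha v
  exact ⟨(2 ^ (n - m) : ℤ_[2]) • w, by rw [hw, smul_smul, ← pow_add, Nat.add_sub_cancel' h]⟩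

end Reduction

section Symbols

variable {W : Type*} [AddCommGroup W] [Module (ZMod 2) W] {V : Type*} [AddCommGroup V]
  [Module ℤ_[2] V] {B : V →ₗ[ℤ_[2]] V →ₗ[ℤ_[2]] ℤ_[2]} {e : Red V 2 ≃+ W}

/-- `X` is the symbol of `a` at level `n`: `a = 1 + 2 ^ n A` with `A` congruent to `X` modulo `2`.
It identifies the layer `Γ(2 ^ n) / Γ(2 ^ (n + 1))` with a space of endomorphisms. -/
def IsSymbol (e : Red V 2 ≃+ W) (n : ℕ) (a : Sp B) (X : Module.End (ZMod 2) W) : Prop :=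
  ∀ v, ∃ w, a.1 v = v + (2 ^ n : ℤ_[2]) • w ∧ redVec e w = X (redVec e v)

variable {n : ℕ} {a b : Sp B} {X Y : Module.End (ZMod 2) W}

theorem IsSymbol.mem_Gam (h : IsSymbol e n a X) : a ∈ Gam B (2 ^ n) :=
  mem_Gam_iff.2 fun v => (h v).imp fun _ hw => hw.1

theorem isSymbol_zero_iff : IsSymbol e n a 0 ↔ a ∈ Gam B (2 ^ (n + 1)) := by
  rw [mem_Gam_iff]
  refine forall_congr' fun v => ⟨?_, ?_⟩
  · rintro ⟨w, hw, hw'⟩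
    obtain ⟨u, rfl⟩ := redVec_eq_zero_iff.1 hw'
    exact ⟨u, by rw [hw, smul_smul, ← pow_succ]⟩
  · rintro ⟨w, hw⟩
    exact ⟨(2 : ℤ_[2]) • w, by rw [hw, smul_smul, ← pow_succ], redVec_two_smul w⟩

theorem isSymbol_one : IsSymbol e n (1 : Sp B) 0 := isSymbol_zero_iff.2 (one_mem _)

theorem IsSymbol.redVec_apply (hn : n ≠ 0) (h : IsSymbol e n a X) (v : V) :
    redVec e (a.1 v) = redVec e v := by
  obtain ⟨w, hw, -⟩ := h v
  rw [hw, map_add, redVec_two_pow_smul hn, add_zero]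

theorem IsSymbol.mul (hn : n ≠ 0) (ha : IsSymbol e n a X) (hb : IsSymbol e n b Y) :
    IsSymbol e n (a * b) (X + Y) := by
  intro v
  obtain ⟨w, hw, hw'⟩ := hb v
  obtain ⟨u, hu, hu'⟩ := ha (b.1 v)
  refine ⟨w + u, by rw [mul_val_apply, hu, hw, smul_add, add_assoc], ?_⟩
  rw [map_add, hw', hu', hb.redVec_apply hn, LinearMap.add_apply, add_comm]

theorem IsSymbol.conj (h : IsSymbol e n a X) (g : Sp B) {T : Module.End (ZMod 2) W}
    (hT : ∀ v, redVec e (g.1 v) = T (redVec e v)) (hY : Y * T = T * X) :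
    IsSymbol e n (g * a * g⁻¹) Y := by
  intro v
  obtain ⟨w, hw, hw'⟩ := h (g⁻¹.1 v)
  refine ⟨g.1 w, ?_, ?_⟩
  · rw [mul_val_apply, mul_val_apply, hw, map_add, map_smul, val_inv_apply]
  · rw [hT, hw', ← Module.End.mul_apply, ← hY, Module.End.mul_apply, ← hT, val_inv_apply]

theorem IsSymbol.of_inv_mul_mem_Gam (hn : n ≠ 0) (ha : IsSymbol e n a X)
    (h : a⁻¹ * b ∈ Gam B (2 ^ (n + 1))) : IsSymbol e n b X := by
  have hb := ha.mul hn (isSymbol_zero_iff (e := e).2 h)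
  rwa [mul_inv_cancel_left, add_zero] at hb

theorem IsSymbol.sq (hn : 2 ≤ n) (ha : IsSymbol e n a X) : IsSymbol e (n + 1) (a * a) X := by
  intro v
  obtain ⟨w, hw, hw'⟩ := ha v
  obtain ⟨u, hu, -⟩ := ha w
  refine ⟨w + (2 ^ (n - 1) : ℤ_[2]) • u, ?_, ?_⟩
  · rw [mul_val_apply, hw, map_add, map_smul, hw, hu, smul_add, smul_add, smul_smul, smul_smul,
      ← pow_add, ← pow_add, show n + 1 + (n - 1) = n + n by lia, pow_succ]
    module
  · rw [map_add, redVec_two_pow_smul (by lia), add_zero, hw']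

theorem IsSymbol.sq_one (ha : IsSymbol e 1 a X) : IsSymbol e 2 (a * a) (X + X * X) := by
  intro v
  obtain ⟨w, hw, hw'⟩ := ha v
  obtain ⟨u, hu, hu'⟩ := ha w
  refine ⟨w + u, ?_, ?_⟩
  · rw [mul_val_apply, hw, map_add, map_smul, hw, hu]
    module
  · rw [map_add, hw', hu', hw', LinearMap.add_apply, Module.End.mul_apply]

theorem IsSymbol.commutator {m : ℕ} (hm : m ≠ 0) (hn : n ≠ 0) (ha : IsSymbol e m a X)
    (hb : IsSymbol e n b Y) : IsSymbol e (m + n) (a * b * (b * a)⁻¹) (X * Y + Y * X) := by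
  intro v
  set u := (b * a)⁻¹.1 v with hu
  have hv : v = b.1 (a.1 u) := by rw [← mul_val_apply, hu, val_inv_apply]
  have huv : redVec e v = redVec e u := by rw [hv, hb.redVec_apply hn, ha.redVec_apply hm]
  obtain ⟨p, hp, hp'⟩ := ha u
  obtain ⟨q, hq, hq'⟩ := hb u
  obtain ⟨r, hr, hr'⟩ := ha q
  obtain ⟨s, hs, hs'⟩ := hb p
  refine ⟨r - s, ?_, ?_⟩
  · rw [mul_val_apply, mul_val_apply, ← hu, hv, hp, hq]
    simp only [map_add, map_smul, hp, hq, hr, hs, pow_add]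
    module
  · rw [map_sub, hr', hs', hq', hp', huv, ZModModule.sub_eq_add, LinearMap.add_apply,
      Module.End.mul_apply, Module.End.mul_apply]

theorem IsSymbol.mem_selfAdjointSubmodule {ω : W →ₗ[ZMod 2] W →ₗ[ZMod 2] ZMod 2}
    (he : ∀ v w : V, ω (redVec e v) (redVec e w) = PadicInt.toZMod (B v w)) (hn : n ≠ 0)
    (ha : IsSymbol e n a X) : X ∈ ω.selfAdjointSubmodule := by
  refine mem_selfAdjointSubmodule_iff_apply.2 fun x y => ?_
  obtain ⟨v, rfl⟩ := redVec_surjective (e := e) x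
  obtain ⟨w, rfl⟩ := redVec_surjective (e := e) y
  obtain ⟨p, hp, hp'⟩ := ha v
  obtain ⟨q, hq, hq'⟩ := ha w
  have hpres := a.2 v w
  rw [hp, hq] at hpres
  simp only [map_add, map_smul, LinearMap.add_apply, LinearMap.smul_apply, smul_eq_mul] at hpres
  have hsum : B p w + B v q + 2 ^ n * B p q = 0 := by
    refine (mul_eq_zero.1 (?_ : (2 ^ n : ℤ_[2]) * _ = 0)).resolve_left
      (pow_ne_zero n two_ne_zero)
    linear_combination hpres
  have hred := congrArg PadicInt.toZMod hsum
  rw [map_add, map_add, map_mul, toZMod_eq_zero_iff.2 (dvd_pow_self 2 hn), zero_mul, add_zero,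
    map_zero, ← he, ← he, hp', hq'] at hred
  exact CharTwo.add_eq_zero.1 hred

variable [Module.Free ℤ_[2] V]

theorem IsSymbol.unique (ha : IsSymbol e n a X) (hb : IsSymbol e n a Y) : X = Y := by
  refine LinearMap.ext fun x => ?_
  obtain ⟨v, rfl⟩ := redVec_surjective (e := e) x
  obtain ⟨w, hw, hw'⟩ := ha v
  obtain ⟨u, hu, hu'⟩ := hb v
  rw [← hw', ← hu', two_pow_smul_injective n (add_left_cancel (hw.symm.trans hu))]

theorem exists_isSymbol (e : Red V 2 ≃+ W) (ha : a ∈ Gam B (2 ^ n)) : ∃ X, IsSymbol e n a X := by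
  choose A hA using mem_Gam_iff.1 ha
  have hadd : ∀ v w, A (v + w) = A v + A w := by
    intro v w
    refine two_pow_smul_injective n (add_left_cancel (a := v + w) ?_)
    dsimp only
    rw [← hA, map_add, hA, hA, smul_add]
    abel
  have hsmul : ∀ (c : ℤ_[2]) v, A (c • v) = c • A v := by
    intro c v
    refine two_pow_smul_injective n (add_left_cancel (a := c • v) ?_)
    dsimp only
    rw [← hA, map_smul, hA, smul_add, smul_comm]
  have hcongr : ∀ v w, redVec e v = redVec e w → redVec e (A v) = redVec e (A w) := by
    intro v w h
    obtain ⟨u, rfl⟩ := redVec_eq_iff.1 h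
    rw [hadd, hsmul, map_add, redVec_two_smul, add_zero]
  let s : W → V := Function.surjInv (redVec_surjective (e := e))
  have hs : ∀ x, redVec e (s x) = x := Function.surjInv_eq (redVec_surjective (e := e))
  let X : W →+ W := AddMonoidHom.mk' (fun x => redVec e (A (s x))) fun x y => by
    rw [← map_add, ← hadd]
    exact hcongr _ _ (by rw [map_add, hs, hs, hs])
  exact ⟨X.toZModLinearMap 2, fun v => ⟨A v, hA v, hcongr _ _ (hs _).symm⟩⟩

theorem IsSymbol.inv (hn : n ≠ 0) (ha : IsSymbol e n a X) : IsSymbol e n a⁻¹ X := by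
  obtain ⟨Y, hY⟩ := exists_isSymbol e (inv_mem ha.mem_Gam)
  have hone := ha.mul hn hY
  rw [mul_inv_cancel] at hone
  have hXY : X = Y := by
    rw [← sub_eq_zero, ZModModule.sub_eq_add]
    exact hone.unique isSymbol_one
  exact hXY ▸ hY

theorem IsSymbol.inv_mul_mem_Gam (hn : n ≠ 0) (ha : IsSymbol e n a X) (hb : IsSymbol e n b X) :
    a⁻¹ * b ∈ Gam B (2 ^ (n + 1)) := by
  rw [← isSymbol_zero_iff (e := e), ← ZModModule.add_self X]
  exact (ha.inv hn).mul hn hb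

end Symbols

section Topology

variable {V : Type*} [AddCommGroup V] [Module ℤ_[2] V]
  {B : V →ₗ[ℤ_[2]] V →ₗ[ℤ_[2]] ℤ_[2]}

theorem hasBasis_nhds_twoAdic (a : Sp B) :
    (@nhds _ (twoAdic B) a).HasBasis (fun _ => True)
      fun n : ℕ => {b | a⁻¹ * b ∈ Gam B (2 ^ n)} := by
  have hnhds : @nhds _ (twoAdic B) a =
      ⨅ n : ℕ, Filter.principal {b : Sp B | a⁻¹ * b ∈ Gam B (2 ^ n)} := by
    rw [twoAdic, nhds_iInf]
    refine iInf_congr fun n => ?_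
    rw [@nhds_induced _ _ ⊥, @nhds_discrete _ ⊥ (@DiscreteTopology.mk _ ⊥ rfl),
      ← Filter.principal_singleton, Filter.comap_principal]
    congr 1
    ext b
    exact eq_comm.trans redSp_eq_iff
  rw [hnhds]
  refine Filter.hasBasis_iInf_principal (directed_of_isDirected_le fun m n h b hb => ?_)
  exact Gam_antitone h hb

theorem mem_of_isClosed {G : Subgroup (Sp B)} (hG : IsClosed[twoAdic B] (G : Set (Sp B)))
    {a : Sp B} (h : ∀ n, ∃ g ∈ G, g⁻¹ * a ∈ Gam B (2 ^ n)) : a ∈ G := by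
  rw [← SetLike.mem_coe, ← @IsClosed.closure_eq _ (twoAdic B) _ hG,
    @mem_closure_iff_nhds_basis _ (twoAdic B) _ _ _ _ _ (hasBasis_nhds_twoAdic a)]
  rintro n -
  obtain ⟨g, hg, hga⟩ := h n
  refine ⟨g, hg, ?_⟩
  rw [Set.mem_ofPred_eq, ← inv_mem_iff, mul_inv_rev, inv_inv]
  exact hga

theorem isOpen_of_Gam_le {G : Subgroup (Sp B)} (n : ℕ) (h : Gam B (2 ^ n) ≤ G) :
    IsOpen[twoAdic B] (G : Set (Sp B)) := by
  refine (@isOpen_iff_mem_nhds _ (twoAdic B) _).2 fun a ha => ?_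
  refine (hasBasis_nhds_twoAdic a).mem_iff.2 ⟨n, trivial, fun b hb => ?_⟩
  have hab := mul_mem ha (h hb)
  rwa [mul_inv_cancel_left] at hab

end Topology

section Transvections

variable {V : Type*} [AddCommGroup V] [Module ℤ_[2] V] {B : V →ₗ[ℤ_[2]] V →ₗ[ℤ_[2]] ℤ_[2]}

/-- The symplectic transvection `v ↦ v + c ⟨v, u⟩ u`. -/
noncomputable def transvection (hB : B.IsAlt) (c : ℤ_[2]) (u : V) : Sp B :=
  ⟨LinearEquiv.transvection (f := c • B.flip u) (v := u) (by simp [hB.self_eq_zero]), by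
    intro v w
    simp only [LinearEquiv.transvection.apply, LinearMap.smul_apply, LinearMap.flip_apply,
      map_add, map_smul, LinearMap.add_apply, smul_eq_mul, hB.self_eq_zero]
    rw [← hB.neg u w]
    ring⟩

theorem transvection_apply (hB : B.IsAlt) (c : ℤ_[2]) (u v : V) :
    (transvection hB c u).1 v = v + (c * B v u) • u := rfl

theorem Sp_ext {a b : Sp B} (h : ∀ v, a.1 v = b.1 v) : a = b :=
  Subtype.ext (LinearEquiv.ext h)

theorem transvection_mul (hB : B.IsAlt) (c c' : ℤ_[2]) (u : V) :
    transvection hB c u * transvection hB c' u = transvection hB (c + c') u := by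
  refine Sp_ext fun v => ?_
  simp only [mul_val_apply, transvection_apply, LinearMap.map_add₂, LinearMap.map_smul₂,
    hB.self_eq_zero, smul_zero, add_zero]
  module

theorem transvection_commute (hB : B.IsAlt) (c c' : ℤ_[2]) {u u' : V} (h : B u u' = 0) :
    Commute (transvection hB c u) (transvection hB c' u') := by
  have h' : B u' u = 0 := by rw [← hB.neg, h, neg_zero]
  refine Sp_ext fun v => ?_
  simp only [mul_val_apply, transvection_apply, LinearMap.map_add₂, LinearMap.map_smul₂, h, h',
    smul_zero, add_zero]
  module

variable {W : Type*} [AddCommGroup W] [Module (ZMod 2) W] {e : Red V 2 ≃+ W}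
  {ω : W →ₗ[ZMod 2] W →ₗ[ZMod 2] ZMod 2}

theorem isSymbol_transvection (hB : B.IsAlt)
    (he : ∀ v w : V, ω (redVec e v) (redVec e w) = PadicInt.toZMod (B v w)) (n : ℕ) (u : V) :
    IsSymbol e n (transvection hB (2 ^ n) u) (squareEnd ω (redVec e u)) := by
  intro v
  refine ⟨B v u • u, by rw [transvection_apply, mul_smul], ?_⟩
  rw [map_smulₛₗ, squareEnd_apply, he]

end Transvections

section Lifts

variable {d : ℕ} {V : Type*} [AddCommGroup V] [Module ℤ_[2] V]
  {B : V →ₗ[ℤ_[2]] V →ₗ[ℤ_[2]] ℤ_[2]} {e : Red V 2 ≃+ StdSpace d} {a b : Sp B}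
  {σ τ : Equiv.Perm (Fin d)}

/-- `a` reduces modulo `2` to the action of the permutation `σ`. -/
def Lifts (e : Red V 2 ≃+ StdSpace d) (a : Sp B) (σ : Equiv.Perm (Fin d)) : Prop :=
  ∀ v, redVec e (a.1 v) = permStd σ (redVec e v)

theorem Lifts.mul (ha : Lifts e a σ) (hb : Lifts e b τ) : Lifts e (a * b) (σ * τ) := by
  intro v
  rw [mul_val_apply, ha, hb, permStd_mul]

theorem Lifts.inv (ha : Lifts e a σ) : Lifts e a⁻¹ σ⁻¹ := by
  intro v
  have h := ha (a⁻¹.1 v)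
  rw [val_inv_apply] at h
  rw [h, permStd_inv_apply]

theorem lifts_one_iff : Lifts e a 1 ↔ a ∈ Gam B 2 := by
  refine Iff.trans ?_ (mem_Gam_iff (n := 1)).symm
  refine forall_congr' fun v => ?_
  rw [permStd_one, redVec_eq_iff, pow_one]

theorem lifts_one : Lifts e (1 : Sp B) 1 := lifts_one_iff.2 (one_mem _)

theorem Lifts.of_redSp_eq (ha : Lifts e a σ) (h : redSp B 2 a = redSp B 2 b) : Lifts e b σ := by
  have hab := ha.mul (lifts_one_iff.2 (redSp_eq_iff.1 h))
  rwa [mul_inv_cancel_left, mul_one] at hab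

theorem redSp_mem_stdImage_iff : redSp B 2 a ∈ stdImage B d e ↔ ∃ σ, Lifts e a σ := by
  constructor
  · rintro ⟨s, ⟨σ, rfl⟩, h⟩
    exact ⟨σ, fun v => h ((multiples V 2).mkQ v)⟩
  · rintro ⟨σ, h⟩
    exact ⟨stdRep d σ, ⟨σ, rfl⟩, (multiples V 2).mkQ_surjective.forall.2 h⟩

theorem IsSymbol.lifts_one {n : ℕ} {X : Module.End (ZMod 2) (StdSpace d)} (hn : n ≠ 0)
    (h : IsSymbol e n a X) : Lifts e a 1 :=
  lifts_one_iff.2 (Gam_antitone (Nat.one_le_iff_ne_zero.2 hn) h.mem_Gam)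

theorem IsSymbol.conj_of_lifts {n : ℕ} {X : Module.End (ZMod 2) (StdSpace d)} (h : IsSymbol e n a X)
    {g : Sp B} (hg : Lifts e g σ) : IsSymbol e n (g * a * g⁻¹) (permConj σ X) :=
  h.conj g (T := permStd σ) hg <| LinearMap.ext fun y => by
    rw [Module.End.mul_apply, permConj_apply]
    exact congrArg _ (congrArg _ (permStd_inv_apply σ y))

theorem lifts_transvection (hB : B.IsAlt)
    (he : ∀ v w : V, stdForm d (redVec e v) (redVec e w) = PadicInt.toZMod (B v w))
    {i j : Fin d} {u : V} (hu : redVec e u = pairVec i j) :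
    Lifts e (transvection hB 1 u) (Equiv.swap i j) := by
  intro v
  rw [transvection_apply, map_add, map_smulₛₗ, one_mul, ← he, permStd_swap, hu]

theorem exists_lifts (hB : B.IsAlt)
    (he : ∀ v w : V, stdForm d (redVec e v) (redVec e w) = PadicInt.toZMod (B v w))
    {G : Subgroup (Sp B)} (hG : stdImage B d e ≤ G.map (redSp B 2)) (σ : Equiv.Perm (Fin d)) :
    ∃ g ∈ G, Lifts e g σ := by
  refine Equiv.Perm.swap_induction_on σ ⟨1, one_mem _, lifts_one⟩ ?_
  rintro τ i j - ⟨g, hg, hgτ⟩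
  obtain ⟨u, hu⟩ := redVec_surjective (e := e) (pairVec i j)
  have ht := lifts_transvection hB he hu
  obtain ⟨t, htG, htu⟩ := hG (redSp_mem_stdImage_iff.2 ⟨_, ht⟩)
  exact ⟨t * g, mul_mem htG hg, (ht.of_redSp_eq htu.symm).mul hgτ⟩

end Lifts

section Layers

variable {W : Type*} [AddCommGroup W] [Module (ZMod 2) W] {V : Type*} [AddCommGroup V]
  [Module ℤ_[2] V] {B : V →ₗ[ℤ_[2]] V →ₗ[ℤ_[2]] ℤ_[2]} {e : Red V 2 ≃+ W}

/-- The layer of `G` between `Γ(2 ^ (n + 1))` and `Γ(2 ^ (n + 2))`: the symbols at level `n + 1`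
of elements of `G`. The shift of the index excludes level `0`, where symbols do not add. -/
def layer (e : Red V 2 ≃+ W) (G : Subgroup (Sp B)) (n : ℕ) :
    Submodule (ZMod 2) (Module.End (ZMod 2) W) :=
  AddSubgroup.toZModSubmodule 2
    { carrier := {X | ∃ a ∈ G, IsSymbol e (n + 1) a X}
      add_mem' := by
        rintro X Y ⟨a, ha, hX⟩ ⟨b, hb, hY⟩
        exact ⟨a * b, mul_mem ha hb, hX.mul n.succ_ne_zero hY⟩
      zero_mem' := ⟨1, one_mem _, isSymbol_one⟩
      neg_mem' := by intro X hX; rwa [ZModModule.neg_eq_self] }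

variable {G : Subgroup (Sp B)} {n : ℕ} {X : Module.End (ZMod 2) W}

theorem mem_layer_iff : X ∈ layer e G n ↔ ∃ a ∈ G, IsSymbol e (n + 1) a X := Iff.rfl

theorem layer_le_layer_succ (hn : n ≠ 0) : layer e G n ≤ layer e G (n + 1) := by
  rintro X ⟨a, ha, hX⟩
  exact ⟨a * a, mul_mem ha ha, hX.sq (by lia)⟩

theorem layer_le_layer {m : ℕ} (hn : n ≠ 0) (hnm : n ≤ m) : layer e G n ≤ layer e G m := by
  induction m, hnm using Nat.le_induction with
  | base => exact le_rfl
  | succ k hk ih => exact ih.trans (layer_le_layer_succ (by lia))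

theorem add_mul_self_mem_layer_one (hX : X ∈ layer e G 0) : X + X * X ∈ layer e G 1 := by
  obtain ⟨a, ha, hX⟩ := hX
  exact ⟨a * a, mul_mem ha ha, hX.sq_one⟩

variable {ω : W →ₗ[ZMod 2] W →ₗ[ZMod 2] ZMod 2}

theorem layer_le_selfAdjointSubmodule
    (he : ∀ v w : V, ω (redVec e v) (redVec e w) = PadicInt.toZMod (B v w)) :
    layer e G n ≤ ω.selfAdjointSubmodule := by
  rintro X ⟨a, -, hX⟩
  exact hX.mem_selfAdjointSubmodule he n.succ_ne_zero

variable [Module.Free ℤ_[2] V]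

theorem Gam_le_of_layers
    (he : ∀ v w : V, ω (redVec e v) (redVec e w) = PadicInt.toZMod (B v w))
    (hG : IsClosed[twoAdic B] (G : Set (Sp B)))
    (h : ∀ m, n ≤ m → ω.selfAdjointSubmodule ≤ layer e G m) : Gam B (2 ^ (n + 1)) ≤ G := by
  intro a ha
  have happrox : ∀ k, ∃ g ∈ G, g⁻¹ * a ∈ Gam B (2 ^ (n + k + 1)) := by
    intro k
    induction k with
    | zero => exact ⟨1, one_mem _, by rwa [inv_one, one_mul]⟩
    | succ k ih =>
      obtain ⟨g, hg, hga⟩ := ih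
      obtain ⟨X, hX⟩ := exists_isSymbol e hga
      obtain ⟨b, hb, hbX⟩ :=
        h (n + k) (Nat.le_add_right n k) (hX.mem_selfAdjointSubmodule he (Nat.succ_ne_zero _))
      refine ⟨g * b, mul_mem hg hb, ?_⟩
      rw [mul_inv_rev, mul_assoc]
      exact hbX.inv_mul_mem_Gam (Nat.succ_ne_zero _) hX
  refine mem_of_isClosed hG fun k => ?_
  obtain ⟨g, hg, hga⟩ := happrox k
  exact ⟨g, hg, Gam_antitone (by lia) hga⟩

end Layers

section PermutationLayers

variable {d : ℕ} {V : Type*} [AddCommGroup V] [Module ℤ_[2] V]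
  {B : V →ₗ[ℤ_[2]] V →ₗ[ℤ_[2]] ℤ_[2]} {e : Red V 2 ≃+ StdSpace d} {G : Subgroup (Sp B)}

theorem permStable_layer (hG : ∀ σ, ∃ g ∈ G, Lifts e g σ) (n : ℕ) :
    PermStable (layer e G n) := by
  rintro σ X ⟨a, ha, hX⟩
  obtain ⟨g, hg, hgσ⟩ := hG σ
  exact ⟨g * a * g⁻¹, mul_mem (mul_mem hg ha) (inv_mem hg), hX.conj_of_lifts hgσ⟩

theorem selfAdjointSubmodule_le_layer_one (hd : 5 ≤ d) (hG : ∀ σ, ∃ g ∈ G, Lifts e g σ)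
    (h : (stdForm d).selfAdjointSubmodule ≤ layer e G 0) :
    (stdForm d).selfAdjointSubmodule ≤ layer e G 1 := by
  let i : Fin d := ⟨0, by lia⟩
  let j : Fin d := ⟨1, by lia⟩
  refine (permStable_layer hG 1).selfAdjointSubmodule_le (i := i) (j := j) (by simp [i, j]) ?_
  set s := squareEnd (stdForm d) (pairVec i j)
  have hs : s * s = 0 := by
    refine LinearMap.ext fun x => ?_
    rw [Module.End.mul_apply, squareEnd_apply, squareEnd_apply, map_smul, LinearMap.smul_apply,
      stdForm_self, smul_zero, zero_smul, LinearMap.zero_apply]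
  have hmem := add_mul_self_mem_layer_one (X := s)
    (h (squareEnd_mem_selfAdjointSubmodule stdForm_isSymm _))
  rwa [hs, add_zero] at hmem

end PermutationLayers

/-! ### Lifts of transpositions -/

section SplitsPair

local notation "⟪" x ", " y "⟫" => stdForm _ x y

variable {d : ℕ}

/-- In a representative of `w` the `i`-th and the `j`-th coordinates differ and all the others
agree. The diagonal of a lift modulo `4` of the transposition of `i` and `j` has this shape when
the first layer is alternating. -/
structure SplitsPair (i j : Fin d) (w : StdSpace d) : Prop where
  pairVec_eq_one : ⟪w, pairVec i j⟫ = 1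
  pairVec_eq_zero : ∀ k l, i ≠ k → i ≠ l → j ≠ k → j ≠ l → ⟪w, pairVec k l⟫ = 0

theorem SplitsPair.natCast_mul_eq_one {i j m : Fin d} {y : sumZero d}
    (h : SplitsPair i j ((onesLine d).mkQ y)) (hij : i ≠ j) (him : i ≠ m) (hjm : j ≠ m) :
    (d : ZMod 2) * y.1 m = 1 := by
  have hsum : ∑ k, (y.1 k + y.1 m) = y.1 i + y.1 m + (y.1 j + y.1 m) := by
    refine Finset.sum_eq_add i j hij (fun k _ hk => ?_) (by simp) (by simp)
    rw [← stdForm_mk_pairVec]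
    exact h.pairVec_eq_zero k m hk.1.symm him hk.2.symm hjm
  have hone := h.pairVec_eq_one
  have hy : ∑ k, y.1 k = 0 := y.2
  rw [stdForm_mk_pairVec] at hone
  rw [Finset.sum_add_distrib, hy, Finset.sum_const, Finset.card_univ, Fintype.card_fin,
    nsmul_eq_mul, zero_add] at hsum
  linear_combination hsum + hone + CharTwo.add_self_eq_zero (y.1 m)

theorem SplitsPair.odd {i j m : Fin d} {w : StdSpace d} (h : SplitsPair i j w) (hij : i ≠ j)
    (him : i ≠ m) (hjm : j ≠ m) : Odd d := by
  obtain ⟨y, rfl⟩ := (onesLine d).mkQ_surjective w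
  rw [← ZMod.natCast_eq_one_iff_odd]
  refine (zmod_two_eq_zero_or_one _).resolve_left fun h0 => ?_
  have hone := h.natCast_mul_eq_one hij him hjm
  rw [h0, zero_mul] at hone
  exact zero_ne_one hone

theorem SplitsPair.stdForm_eq_one {i j k l : Fin d} (hij : i ≠ j) (hik : i ≠ k) (hil : i ≠ l)
    (hjk : j ≠ k) (hjl : j ≠ l) (hkl : k ≠ l) {w w' : StdSpace d} (hw : SplitsPair i j w)
    (hw' : SplitsPair k l w') : ⟪w, w'⟫ = 1 := by
  have hd : (d : ZMod 2) = 1 := ZMod.natCast_eq_one_iff_odd.2 (hw.odd hij hik hjk)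
  obtain ⟨y, rfl⟩ := (onesLine d).mkQ_surjective w
  obtain ⟨y', rfl⟩ := (onesLine d).mkQ_surjective w'
  have hy : ∀ m, i ≠ m → j ≠ m → y.1 m = 1 := fun m him hjm => by
    have h := hw.natCast_mul_eq_one hij him hjm
    rwa [hd, one_mul] at h
  have hy' : ∀ m, k ≠ m → l ≠ m → y'.1 m = 1 := fun m hkm hlm => by
    have h := hw'.natCast_mul_eq_one hkl hkm hlm
    rwa [hd, one_mul] at h
  have hprod : ∀ m, (1 + y.1 m) * (1 + y'.1 m) = 0 := by
    intro m
    by_cases hm : i = m ∨ j = m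
    · have hkm : k ≠ m := by rcases hm with rfl | rfl <;> symm <;> assumption
      have hlm : l ≠ m := by rcases hm with rfl | rfl <;> symm <;> assumption
      rw [hy' m hkm hlm, CharTwo.add_self_eq_zero, mul_zero]
    · rw [not_or] at hm
      rw [hy m hm.1 hm.2, CharTwo.add_self_eq_zero, zero_mul]
  have hsum : ∑ m, (1 + y.1 m) * (1 + y'.1 m) = 0 := Finset.sum_eq_zero fun m _ => hprod m
  have hy0 : ∑ m, y.1 m = 0 := y.2
  have hy0' : ∑ m, y'.1 m = 0 := y'.2
  simp only [add_mul, mul_add, one_mul, mul_one, Finset.sum_add_distrib, hy0, hy0',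
    Finset.sum_const, Finset.card_univ, Fintype.card_fin, nsmul_one, hd, add_zero, zero_add]
    at hsum
  rw [stdForm_mk]
  exact (CharTwo.add_eq_zero.1 hsum).symm

end SplitsPair

section OrthogonalLifts

variable {W : Type*} [AddCommGroup W] [Module (ZMod 2) W] {V : Type*} [AddCommGroup V]
  [Module ℤ_[2] V] {B : V →ₗ[ℤ_[2]] V →ₗ[ℤ_[2]] ℤ_[2]} {e : Red V 2 ≃+ W}
  {ω : W →ₗ[ZMod 2] W →ₗ[ZMod 2] ZMod 2}
  (he : ∀ v w : V, ω (redVec e v) (redVec e w) = PadicInt.toZMod (B v w))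

include he

theorem isUnit_of_form_eq_one {v w : V} (h : ω (redVec e v) (redVec e w) = 1) :
    IsUnit (B v w) := by
  by_contra hc
  rw [← mem_nonunits_iff, ← IsLocalRing.mem_maximalIdeal, ← PadicInt.ker_toZMod,
    RingHom.mem_ker, ← he, h] at hc
  exact one_ne_zero hc

theorem exists_lift_orthogonal {v : V} {x y : W} (hx : ω (redVec e v) x = 1)
    (hy : ω (redVec e v) y = 0) : ∃ u, redVec e u = y ∧ B v u = 0 := by
  obtain ⟨h, rfl⟩ := redVec_surjective (e := e) x
  obtain ⟨u, rfl⟩ := redVec_surjective (e := e) y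
  obtain ⟨c, hc⟩ := isUnit_of_form_eq_one he hx
  refine ⟨u - (B v u * ↑c⁻¹) • h, ?_, ?_⟩
  · rw [map_sub, map_smulₛₗ, map_mul, ← he, hy, zero_mul, zero_smul, sub_zero]
  · rw [map_sub, map_smul, smul_eq_mul, ← hc, Units.inv_mul_cancel_right, sub_self]

theorem exists_lift_orthogonal_pair (hB : B.IsAlt) {v w : V} {y : W}
    (hvw : ω (redVec e v) (redVec e w) = 1) (hv : ω (redVec e v) y = 0)
    (hw : ω (redVec e w) y = 0) : ∃ u, redVec e u = y ∧ B v u = 0 ∧ B w u = 0 := by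
  obtain ⟨u, rfl⟩ := redVec_surjective (e := e) y
  obtain ⟨c, hc⟩ := isUnit_of_form_eq_one he hvw
  refine ⟨u - (B v u * ↑c⁻¹) • w + (B w u * ↑c⁻¹) • v, ?_, ?_, ?_⟩
  · rw [map_add, map_sub, map_smulₛₗ, map_smulₛₗ, map_mul, map_mul, ← he, ← he, hv, hw, zero_mul,
      zero_smul, sub_zero, zero_smul, add_zero]
  · rw [map_add, map_sub, map_smul, map_smul, hB.self_eq_zero, smul_zero, add_zero, smul_eq_mul,
      ← hc, Units.inv_mul_cancel_right, sub_self]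
  · rw [map_add, map_sub, map_smul, map_smul, hB.self_eq_zero, smul_zero, sub_zero, smul_eq_mul,
      ← hB.neg v w, ← hc, mul_neg, Units.inv_mul_cancel_right, add_neg_cancel]

end OrthogonalLifts

section SwapLifts

local notation "⟪" x ", " y "⟫" => stdForm _ x y
local infixl:70 " ⋏ " => wedgeEnd (stdForm _)
local postfix:max "²" => squareEnd (stdForm _)

variable {d : ℕ} {V : Type*} [AddCommGroup V] [Module ℤ_[2] V]
  {B : V →ₗ[ℤ_[2]] V →ₗ[ℤ_[2]] ℤ_[2]} {e : Red V 2 ≃+ StdSpace d} {G : Subgroup (Sp B)}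
  {X : Module.End (ZMod 2) (StdSpace d)}

theorem IsSymbol.sq_of_swap (hB : B.IsAlt)
    (he : ∀ v w : V, stdForm d (redVec e v) (redVec e w) = PadicInt.toZMod (B v w))
    {i j : Fin d} {v : V} (hv : redVec e v = pairVec i j) {a : Sp B} (ha : IsSymbol e 1 a X) :
    IsSymbol e 1 (transvection hB 1 v * a * (transvection hB 1 v * a))
      (pairVec i j ⋏ X (pairVec i j) +
        (1 + ⟪X (pairVec i j), pairVec i j⟫) • (pairVec i j)²) := by
  have hT := lifts_transvection hB he hv
  have hsq : IsSymbol e 1 (transvection hB (1 + 1) v) (pairVec i j)² := by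
    rw [one_add_one_eq_two, ← hv, ← pow_one (2 : ℤ_[2])]
    exact isSymbol_transvection hB he 1 v
  have h := (hsq.mul one_ne_zero (ha.conj_of_lifts hT.inv)).mul one_ne_zero ha
  rw [Equiv.swap_inv] at h
  convert h using 1
  · rw [← transvection_mul]
    group
  · rw [add_assoc, add_comm (permConj _ _),
      add_permConj_swap (ha.mem_selfAdjointSubmodule he one_ne_zero), add_smul, one_smul]
    abel

variable [Module.Free ℤ_[2] V]

theorem Lifts.exists_isSymbol_inv_mul {t T : Sp B} {σ : Equiv.Perm (Fin d)} (ht : Lifts e t σ)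
    (hT : Lifts e T σ) : ∃ X, IsSymbol e 1 (T⁻¹ * t) X := by
  have h := hT.inv.mul ht
  rw [inv_mul_cancel, lifts_one_iff] at h
  exact exists_isSymbol (n := 1) e h

theorem IsSymbol.commutator_of_swap {n : ℕ} (hn : n ≠ 0)
    (he : ∀ v w : V, stdForm d (redVec e v) (redVec e w) = PadicInt.toZMod (B v w))
    {R R' a a' : Sp B} {i j k l : Fin d} (hR : Lifts e R (Equiv.swap i j))
    (hR' : Lifts e R' (Equiv.swap k l)) {X' Z : Module.End (ZMod 2) (StdSpace d)}
    (hZ : IsSymbol e n ((R' * R)⁻¹ * (R * R')) Z) (ha : IsSymbol e n a X)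
    (ha' : IsSymbol e n a' X') :
    IsSymbol e n ((R' * a' * (R * a))⁻¹ * (R * a * (R' * a')))
      (Z + (pairVec i j ⋏ X' (pairVec i j) +
          ⟪X' (pairVec i j), pairVec i j⟫ • (pairVec i j)²) +
        (pairVec k l ⋏ X (pairVec k l) + ⟪X (pairVec k l), pairVec k l⟫ • (pairVec k l)²)) := by
  have hleft := ((ha'.conj_of_lifts hR.inv).mul hn ha).inv hn
  have hright := (ha.conj_of_lifts hR'.inv).mul hn ha'
  rw [Equiv.swap_inv] at hleft hright
  rw [← add_permConj_swap (ha.mem_selfAdjointSubmodule he hn),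
    ← add_permConj_swap (ha'.mem_selfAdjointSubmodule he hn)]
  convert (hleft.mul hn hZ).mul hn hright using 1
  · group
  · abel

variable (hd : 5 ≤ d) (hB : B.IsAlt)
  (he : ∀ v w : V, stdForm d (redVec e v) (redVec e w) = PadicInt.toZMod (B v w))
  (hG : ∀ σ, ∃ g ∈ G, Lifts e g σ)

include hd hB he hG

theorem alternatingEnd_le_layer_zero : alternatingEnd (stdForm d) ≤ layer e G 0 := by
  let i : Fin d := ⟨0, by lia⟩
  let j : Fin d := ⟨1, by lia⟩
  obtain ⟨t, ht, htσ⟩ := hG (Equiv.swap i j)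
  obtain ⟨v, hv⟩ := redVec_surjective (e := e) (pairVec i j)
  obtain ⟨X, hX⟩ := htσ.exists_isSymbol_inv_mul (lifts_transvection hB he hv)
  have hmem : pairVec i j ⋏ X (pairVec i j) +
      (1 + ⟪X (pairVec i j), pairVec i j⟫) • (pairVec i j)² ∈ layer e G 0 := by
    refine ⟨_, ?_, hX.sq_of_swap hB he hv⟩
    rw [mul_inv_cancel_left]
    exact mul_mem ht ht
  have hM := permStable_layer hG 0
  rw [← Submodule.ker_mkQ (layer e G 0)] at hM ⊢
  exact hM.alternatingEnd_le_of_square hd (i := i) (j := j) (by simp [i, j]) _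
    ((Submodule.Quotient.mk_eq_zero _).2 hmem)

variable (hlayer : layer e G 0 ≤ alternatingEnd (stdForm d)) {i j : Fin d} (hij : i ≠ j) {v : V}
  (hv : redVec e v = pairVec i j) {a : Sp B} (haG : transvection hB 1 v * a ∈ G)
  (ha : IsSymbol e 1 a X)

include hlayer hij hv haG ha

omit [Module.Free ℤ_[2] V] hG in
theorem stdForm_apply_pairVec_eq_one : ⟪X (pairVec i j), pairVec i j⟫ = 1 := by
  obtain ⟨m, him, hjm, -, -⟩ := exists_ne_four hd i j i j
  have h := hlayer ⟨_, mul_mem haG haG, ha.sq_of_swap hB he hv⟩ (pairVec i m)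
  rw [LinearMap.add_apply, LinearMap.map_add₂, wedgeEnd_mem_alternatingEnd stdForm_isSymm,
    zero_add, LinearMap.smul_apply, LinearMap.map_smul₂, apply_squareEnd_self stdForm_isSymm,
    stdForm_comm (pairVec i m), stdForm_pairVec_of_common hij him hjm, smul_eq_mul, mul_one] at h
  exact (CharTwo.add_eq_zero.1 h).symm

theorem stdForm_apply_pairVec_eq_zero {k l : Fin d} (hik : i ≠ k) (hil : i ≠ l) (hjk : j ≠ k)
    (hjl : j ≠ l) : ⟪X (pairVec k l), pairVec k l⟫ = 0 := by
  rcases eq_or_ne k l with rfl | hkl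
  · rw [pairVec_self, map_zero]
  obtain ⟨m, him, hjm, hkm, hlm⟩ := exists_ne_four hd i j k l
  obtain ⟨v', hv', hvv'⟩ := exists_lift_orthogonal he (v := v) (x := pairVec i k)
    (y := pairVec k l) (by rw [hv, stdForm_pairVec_of_common hij hik hjk])
    (by rw [hv, stdForm_pairVec_of_disjoint hik hil hjk hjl])
  obtain ⟨t, ht, htσ⟩ := hG (Equiv.swap k l)
  have hT' := lifts_transvection hB he hv'
  obtain ⟨X', hX'⟩ := htσ.exists_isSymbol_inv_mul hT'
  have hZ : IsSymbol e 1 ((transvection hB 1 v' * transvection hB 1 v)⁻¹ *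
      (transvection hB 1 v * transvection hB 1 v')) 0 := by
    rw [transvection_commute hB 1 1 hvv', inv_mul_cancel]
    exact isSymbol_one
  have hcomm := IsSymbol.commutator_of_swap one_ne_zero he (lifts_transvection hB he hv) hT' hZ
    ha hX'
  rw [mul_inv_cancel_left] at hcomm
  have h := hlayer ⟨_, mul_mem (inv_mem (mul_mem ht haG)) (mul_mem haG ht), hcomm⟩ (pairVec k m)
  have hwedge := fun x y => wedgeEnd_mem_alternatingEnd (stdForm_isSymm (d := d)) x y (pairVec k m)
  simpa only [zero_add, LinearMap.add_apply, LinearMap.map_add₂, LinearMap.smul_apply,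
    LinearMap.map_smul₂, hwedge, apply_squareEnd_self stdForm_isSymm, smul_eq_mul,
    stdForm_comm (pairVec k m), stdForm_pairVec_of_disjoint hik him hjk hjm,
    stdForm_pairVec_of_common hkl hkm hlm, mul_zero, mul_one] using h

theorem splitsPair_of_isDiagonal {w : StdSpace d} (hw : IsDiagonal (stdForm d) X w) :
    SplitsPair i j w where
  pairVec_eq_one := by
    rw [stdForm_comm, ← hw]
    exact stdForm_apply_pairVec_eq_one hd hB he hlayer hij hv haG ha
  pairVec_eq_zero k l hik hil hjk hjl := by
    rw [stdForm_comm, ← hw]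
    exact stdForm_apply_pairVec_eq_zero hd hB he hG hlayer hij hv haG ha hik hil hjk hjl

end SwapLifts

section FirstLayers

local notation "⟪" x ", " y "⟫" => stdForm _ x y
local infixl:70 " ⋏ " => wedgeEnd (stdForm _)
local postfix:max "²" => squareEnd (stdForm _)

variable {d : ℕ} {V : Type*} [AddCommGroup V] [Module ℤ_[2] V]
  {B : V →ₗ[ℤ_[2]] V →ₗ[ℤ_[2]] ℤ_[2]} {e : Red V 2 ≃+ StdSpace d} {G : Subgroup (Sp B)}

theorem containsDisjoint_layer_one (h : alternatingEnd (stdForm d) ≤ layer e G 0) :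
    ContainsDisjoint (layer e G 1) := by
  intro i j k l hik hil hjk hjl
  set P := pairVec i j ⋏ pairVec k l with hP
  have hPP : P * P = 0 := by
    refine LinearMap.ext fun x => ?_
    rw [Module.End.mul_apply, hP, wedgeEnd_apply _ _ x, map_add, map_smul, map_smul,
      wedgeEnd_apply, wedgeEnd_apply, stdForm_self, stdForm_self, stdForm_comm (pairVec k l),
      stdForm_pairVec_of_disjoint hik hil hjk hjl]
    simp only [zero_smul, add_zero, smul_zero, LinearMap.zero_apply]
  have hmem :=
    add_mul_self_mem_layer_one (X := P) (h (wedgeEnd_mem_alternatingEnd stdForm_isSymm _ _))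
  rwa [hPP, add_zero] at hmem

theorem squareEnd_mul_add_mul {W : Type*} [AddCommGroup W] [Module (ZMod 2) W]
    {ω : LinearMap.BilinForm (ZMod 2) W} (hω : ω.IsSymm) {x y : W} (h : ω x y = 1) :
    squareEnd ω x * squareEnd ω y + squareEnd ω y * squareEnd ω x = wedgeEnd ω x y := by
  refine LinearMap.ext fun z => ?_
  simp only [LinearMap.add_apply, Module.End.mul_apply, squareEnd_apply, wedgeEnd_apply,
    LinearMap.map_smul₂, hω.eq y x, h, smul_eq_mul, mul_one, add_comm]

theorem isSymbol_commutator_transvection {W : Type*} [AddCommGroup W] [Module (ZMod 2) W]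
    {e : Red V 2 ≃+ W} {ω : LinearMap.BilinForm (ZMod 2) W} (hω : ω.IsSymm)
    [Module.Free ℤ_[2] V] (hB : B.IsAlt)
    (he : ∀ v w : V, ω (redVec e v) (redVec e w) = PadicInt.toZMod (B v w)) {v v' w w' : V}
    (hvv' : B v v' = 0) (hvw' : B v w' = 0) (hwv' : B w v' = 0)
    (hww' : ω (redVec e w) (redVec e w') = 1) :
    IsSymbol e 2 ((transvection hB 1 v' * transvection hB 2 w' *
        (transvection hB 1 v * transvection hB 2 w))⁻¹ *
        (transvection hB 1 v * transvection hB 2 w *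
          (transvection hB 1 v' * transvection hB 2 w')))
      (wedgeEnd ω (redVec e w) (redVec e w')) := by
  have hS := isSymbol_transvection hB he 1 w
  have hS' := isSymbol_transvection hB he 1 w'
  rw [pow_one] at hS hS'
  have hcomm := (hS.inv one_ne_zero).commutator one_ne_zero one_ne_zero (hS'.inv one_ne_zero)
  rw [squareEnd_mul_add_mul hω hww', one_add_one_eq_two] at hcomm
  convert hcomm using 1
  rw [(transvection_commute hB 2 1 hwv').mul_mul_mul_comm,
    (transvection_commute hB 1 2 hvw').symm.mul_mul_mul_comm,
    (transvection_commute hB 1 1 hvv').eq]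
  group

variable [Module.Free ℤ_[2] V] (hd : 5 ≤ d) (hB : B.IsAlt)
  (he : ∀ v w : V, stdForm d (redVec e v) (redVec e w) = PadicInt.toZMod (B v w))
  (hG : ∀ σ, ∃ g ∈ G, Lifts e g σ)

include hd hB he hG

theorem selfAdjointSubmodule_le_layer_zero (heven : Even d) :
    (stdForm d).selfAdjointSubmodule ≤ layer e G 0 := by
  refine (permStable_layer hG 0).selfAdjointSubmodule_le_of_not_le
    (layer_le_selfAdjointSubmodule he) (alternatingEnd_le_layer_zero hd hB he hG) fun hlayer => ?_
  let i : Fin d := ⟨0, by lia⟩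
  let j : Fin d := ⟨1, by lia⟩
  have hij : i ≠ j := by simp [i, j]
  obtain ⟨m, him, hjm, -, -⟩ := exists_ne_four hd i j i j
  obtain ⟨t, ht, htσ⟩ := hG (Equiv.swap i j)
  obtain ⟨v, hv⟩ := redVec_surjective (e := e) (pairVec i j)
  obtain ⟨X, hX⟩ := htσ.exists_isSymbol_inv_mul (lifts_transvection hB he hv)
  obtain ⟨w, hw⟩ := exists_isDiagonal stdForm_isSymm stdForm_nondegenerate
    (hX.mem_selfAdjointSubmodule he one_ne_zero)
  have hsplits := splitsPair_of_isDiagonal hd hB he hG hlayer hij hv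
    (by rwa [mul_inv_cancel_left]) hX hw
  exact Nat.not_odd_iff_even.2 heven (hsplits.odd hij him hjm)

theorem exists_swap_lift (hlayer : layer e G 0 ≤ alternatingEnd (stdForm d)) {i j : Fin d}
    (hij : i ≠ j) {v : V} (hv : redVec e v = pairVec i j) :
    ∃ x, SplitsPair i j x ∧ ∀ w, redVec e w = x →
      ∃ a ∈ Gam B (2 ^ 2), transvection hB 1 v * transvection hB 2 w * a ∈ G := by
  obtain ⟨t, ht, htσ⟩ := hG (Equiv.swap i j)
  obtain ⟨X, hX⟩ := htσ.exists_isSymbol_inv_mul (lifts_transvection hB he hv)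
  obtain ⟨x, hx⟩ := exists_isDiagonal stdForm_isSymm stdForm_nondegenerate
    (hX.mem_selfAdjointSubmodule he one_ne_zero)
  refine ⟨x, splitsPair_of_isDiagonal hd hB he hG hlayer hij hv
    (by rwa [mul_inv_cancel_left]) hX hx, fun w hw => ?_⟩
  obtain ⟨g, hg, hgX⟩ :=
    alternatingEnd_le_layer_zero hd hB he hG (hx.add_squareEnd_mem stdForm_isSymm)
  have hprod := hX.mul one_ne_zero hgX
  rw [← add_assoc, ZModModule.add_self, zero_add] at hprod
  have hw2 := isSymbol_transvection hB he 1 w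
  rw [pow_one, hw] at hw2
  refine ⟨_, hw2.inv_mul_mem_Gam one_ne_zero hprod, ?_⟩
  rw [mul_assoc, mul_inv_cancel_left, mul_assoc, mul_inv_cancel_left]
  exact mul_mem ht hg

theorem exists_disjoint_swap_lifts (hlayer : layer e G 0 ≤ alternatingEnd (stdForm d))
    {i j k l : Fin d} (hij : i ≠ j) (hik : i ≠ k) (hil : i ≠ l) (hjk : j ≠ k) (hjl : j ≠ l)
    (hkl : k ≠ l) : ∃ v v' w w', redVec e v = pairVec i j ∧ redVec e v' = pairVec k l ∧
      B v v' = 0 ∧ B v w' = 0 ∧ B w v' = 0 ∧ ⟪redVec e w, redVec e w'⟫ = 1 ∧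
      (∃ a ∈ Gam B (2 ^ 2), transvection hB 1 v * transvection hB 2 w * a ∈ G) ∧
      ∃ a ∈ Gam B (2 ^ 2), transvection hB 1 v' * transvection hB 2 w' * a ∈ G := by
  obtain ⟨v, hv⟩ := redVec_surjective (e := e) (pairVec i j)
  obtain ⟨x, hx, hxG⟩ := exists_swap_lift hd hB he hG hlayer hij hv
  obtain ⟨w, rfl⟩ := redVec_surjective (e := e) x
  have hvw : ⟪redVec e v, redVec e w⟫ = 1 := by rw [hv, stdForm_comm, hx.pairVec_eq_one]
  obtain ⟨v', hv', hvv', hwv'⟩ := exists_lift_orthogonal_pair he hB (y := pairVec k l) hvw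
    (by rw [hv, stdForm_pairVec_of_disjoint hik hil hjk hjl])
    (hx.pairVec_eq_zero k l hik hil hjk hjl)
  obtain ⟨x', hx', hxG'⟩ := exists_swap_lift hd hB he hG hlayer hkl hv'
  obtain ⟨w', rfl, hvw'⟩ := exists_lift_orthogonal he (y := x') hvw (by
    rw [hv, stdForm_comm]
    exact hx'.pairVec_eq_zero i j hik.symm hjk.symm hil.symm hjl.symm)
  exact ⟨v, v', w, w', hv, hv', hvv', hvw', hwv',
    hx.stdForm_eq_one hij hik hil hjk hjl hkl hx', hxG w rfl, hxG' w' rfl⟩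

theorem alternatingEnd_le_layer_one (hlayer : layer e G 0 ≤ alternatingEnd (stdForm d)) :
    alternatingEnd (stdForm d) ≤ layer e G 1 := by
  obtain ⟨i, j, hij⟩ : ∃ i j : Fin d, i ≠ j := ⟨⟨0, by lia⟩, ⟨1, by lia⟩, by simp⟩
  obtain ⟨k, hik, hjk, -, -⟩ := exists_ne_four hd i j i j
  obtain ⟨l, hil, hjl, hkl, -⟩ := exists_ne_four hd i j k k
  obtain ⟨v, v', w, w', hv, hv', hvv', hvw', hwv', hww', ⟨a, ha, haG⟩, a', ha', haG'⟩ :=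
    exists_disjoint_swap_lifts hd hB he hG hlayer hij hik hil hjk hjl hkl
  have hR := (lifts_transvection hB he hv).mul
    ((isSymbol_transvection hB he 1 w).lifts_one one_ne_zero)
  have hR' := (lifts_transvection hB he hv').mul
    ((isSymbol_transvection hB he 1 w').lifts_one one_ne_zero)
  rw [mul_one, pow_one] at hR hR'
  obtain ⟨K, hK⟩ := exists_isSymbol e ha
  obtain ⟨K', hK'⟩ := exists_isSymbol e ha'
  have hcomm := IsSymbol.commutator_of_swap two_ne_zero he hR hR'
    (isSymbol_commutator_transvection stdForm_isSymm hB he hvv' hvw' hwv' hww') hK hK'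
  have hmem := mem_layer_iff.2 ⟨_, mul_mem (inv_mem (mul_mem haG' haG)) (mul_mem haG haG'), hcomm⟩
  have hM := permStable_layer hG 1
  have hU := containsDisjoint_layer_one (alternatingEnd_le_layer_zero hd hB he hG)
  rw [← Submodule.ker_mkQ (layer e G 1)] at hM hU ⊢
  exact hM.alternatingEnd_le_of_commutator hd hU hij hik hil hjk hjl hkl hww'
    ((Submodule.Quotient.mk_eq_zero _).2 hmem)

end FirstLayers

/-! ### The third layer -/

section ThirdLayer

variable {V : Type*} [AddCommGroup V] [Module ℤ_[2] V] [Module.Free ℤ_[2] V]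
  {B : V →ₗ[ℤ_[2]] V →ₗ[ℤ_[2]] ℤ_[2]} {G : Subgroup (Sp B)}

section Projections

variable {W : Type*} [AddCommGroup W] [Module (ZMod 2) W] {ω : LinearMap.BilinForm (ZMod 2) W}
  {e : Red V 2 ≃+ W}
  (he : ∀ v w : V, ω (redVec e v) (redVec e w) = PadicInt.toZMod (B v w)) (hB : B.IsAlt)

include he hB

theorem IsSymbol.four_dvd_form_of_isIdempotentElem (hlayer : layer e G 2 ≤ alternatingEnd ω)
    {a : Sp B} (ha : a ∈ G) {X : Module.End (ZMod 2) W} (hX : IsSymbol e 1 a X)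
    (halt : X ∈ alternatingEnd ω) (hXX : IsIdempotentElem X) {v w : V}
    (hvw : a.1 v = v + (2 : ℤ_[2]) • w) : 4 ∣ B w v := by
  -- Since `X + X² = 0`, the square of `a` lies in `Γ(8)`, and its symbol there is alternating.
  have hsq := hX.sq_one
  rw [hXX.eq, ZModModule.add_self, isSymbol_zero_iff] at hsq
  obtain ⟨Y, hY⟩ := exists_isSymbol e hsq
  have hYalt := hlayer (mem_layer_iff.2 ⟨_, mul_mem ha ha, hY⟩)
  obtain ⟨p, hp, hpY⟩ := hY v
  obtain ⟨u, hu, huX⟩ := hX w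
  rw [pow_one] at hu
  have hsum : w + u = (2 : ℤ_[2]) • p := by
    refine two_pow_smul_injective 2 (add_left_cancel (a := v) ?_)
    beta_reduce
    rw [smul_smul, show (2 ^ 2 * 2 : ℤ_[2]) = 2 ^ 3 by norm_num, ← hp, mul_val_apply, hvw, map_add,
      map_smul, hvw, hu]
    module
  obtain ⟨r, hr⟩ : 2 ∣ B p v := toZMod_eq_zero_iff.1 (by rw [← he, hpY]; exact hYalt _)
  obtain ⟨s, hs⟩ : 2 ∣ B u w := toZMod_eq_zero_iff.1 (by rw [← he, huX]; exact halt _)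
  have hpres := a.2 w v
  rw [hu, hvw] at hpres
  simp only [map_add, map_smul, LinearMap.add_apply, LinearMap.smul_apply, smul_eq_mul, hB w, hs]
    at hpres
  have hdouble : (2 ^ 1 : ℤ_[2]) * (B u v + 4 * s) = 0 := by linear_combination hpres
  have huv := (mul_eq_zero.1 hdouble).resolve_left (pow_ne_zero 1 two_ne_zero)
  have hform := congrArg (B · v) hsum
  simp only [LinearMap.map_add₂, LinearMap.map_smul₂, smul_eq_mul, hr] at hform
  exact ⟨r + s, by linear_combination hform - huv⟩

theorem apply_mul_add_mul_add_mul_eq_zero (hlayer : layer e G 2 ≤ alternatingEnd ω)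
    (hle : alternatingEnd ω ≤ layer e G 0) {X₁ X₂ X₃ : Module.End (ZMod 2) W}
    (h₁ : X₁ ∈ alternatingEnd ω) (h₂ : X₂ ∈ alternatingEnd ω) (h₃ : X₃ ∈ alternatingEnd ω)
    (hi₁ : IsIdempotentElem X₁) (hi₂ : IsIdempotentElem X₂) (hi₃ : IsIdempotentElem X₃)
    (hi : IsIdempotentElem (X₁ + (X₂ + X₃))) (x : W) :
    ω ((X₁ * X₂ + X₁ * X₃ + X₂ * X₃) x) x = 0 := by
  obtain ⟨v, rfl⟩ := redVec_surjective (e := e) x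
  obtain ⟨a₁, ha₁, hX₁⟩ := hle h₁
  obtain ⟨a₂, ha₂, hX₂⟩ := hle h₂
  obtain ⟨a₃, ha₃, hX₃⟩ := hle h₃
  have hX := hX₁.mul one_ne_zero (hX₂.mul one_ne_zero hX₃)
  obtain ⟨p₁, hp₁, -⟩ := hX₁ v
  obtain ⟨p₂, hp₂, hpX₂⟩ := hX₂ v
  obtain ⟨p₃, hp₃, hpX₃⟩ := hX₃ v
  obtain ⟨p, hp, -⟩ := hX v
  obtain ⟨q₁₂, hq₁₂, hqX₁₂⟩ := hX₁ p₂
  obtain ⟨q₁₃, hq₁₃, hqX₁₃⟩ := hX₁ p₃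
  obtain ⟨q₂₃, hq₂₃, hqX₂₃⟩ := hX₂ p₃
  obtain ⟨r, hr, -⟩ := hX₁ q₂₃
  simp only [zero_add, pow_one] at hp₁ hp₂ hp₃ hp hq₁₂ hq₁₃ hq₂₃ hr
  obtain ⟨c₁, hc₁⟩ := hX₁.four_dvd_form_of_isIdempotentElem he hB hlayer ha₁ h₁ hi₁ hp₁
  obtain ⟨c₂, hc₂⟩ := hX₂.four_dvd_form_of_isIdempotentElem he hB hlayer ha₂ h₂ hi₂ hp₂
  obtain ⟨c₃, hc₃⟩ := hX₃.four_dvd_form_of_isIdempotentElem he hB hlayer ha₃ h₃ hi₃ hp₃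
  obtain ⟨c, hc⟩ := hX.four_dvd_form_of_isIdempotentElem he hB hlayer
    (mul_mem ha₁ (mul_mem ha₂ ha₃)) (add_mem h₁ (add_mem h₂ h₃)) hi hp
  have hexpand : p = p₁ + p₂ + p₃ + (2 : ℤ_[2]) • (q₁₂ + q₁₃ + q₂₃ + (2 : ℤ_[2]) • r) := by
    refine two_pow_smul_injective 1 (add_left_cancel (a := v) ?_)
    beta_reduce
    rw [pow_one, ← hp, mul_val_apply, mul_val_apply]
    simp only [hp₃, hp₂, hp₁, hq₂₃, hq₁₃, hq₁₂, hr, map_add, map_smul]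
    module
  have hform := congrArg (B · v) hexpand
  simp only [LinearMap.map_add₂, LinearMap.map_smul₂, smul_eq_mul, hc₁, hc₂, hc₃, hc] at hform
  have hdvd : 2 ∣ B (q₁₂ + q₁₃ + q₂₃) v := by
    refine ⟨c - c₁ - c₂ - c₃ - B r v, mul_left_cancel₀ (two_ne_zero (α := ℤ_[2])) ?_⟩
    rw [LinearMap.map_add₂, LinearMap.map_add₂]
    linear_combination -hform
  rw [← toZMod_eq_zero_iff, ← he, map_add (redVec e), map_add (redVec e), hqX₁₂, hqX₁₃, hqX₂₃,
    hpX₂, hpX₃] at hdvd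
  exact hdvd

end Projections

local notation "⟪" x ", " y "⟫" => stdForm _ x y
local infixl:70 " ⋏ " => wedgeEnd (stdForm _)

variable {d : ℕ}

theorem stdForm_wedgeEnd_mul_add_mul_add_mul {i j k l m : Fin d} (hij : i ≠ j) (hik : i ≠ k)
    (hil : i ≠ l) (him : i ≠ m) (hjk : j ≠ k) (hjl : j ≠ l) (hjm : j ≠ m) (hkl : k ≠ l)
    (hkm : k ≠ m) (hlm : l ≠ m) :
    ⟪((pairVec i j ⋏ pairVec j k) * (pairVec i j ⋏ pairVec j l) +
      (pairVec i j ⋏ pairVec j k) * (pairVec i j ⋏ pairVec j m) +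
      (pairVec i j ⋏ pairVec j l) * (pairVec i j ⋏ pairVec j m)) (pairVec i k),
      pairVec i k⟫ = 1 := by
  have hji : ∀ {n}, j ≠ n → i ≠ n → ⟪pairVec j n, pairVec i j⟫ = 1 := fun hjn hin => by
    rw [pairVec_comm i, stdForm_pairVec_of_common hjn hij.symm hin.symm]
  have hikij : ⟪pairVec i k, pairVec i j⟫ = 1 := stdForm_pairVec_of_common hik hij hjk.symm
  have hikjn : ∀ {n}, i ≠ n → k ≠ n → ⟪pairVec i k, pairVec j n⟫ = 0 :=
    fun hin hkn => stdForm_pairVec_of_disjoint hij hin hjk.symm hkn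
  have hjkik : ⟪pairVec j k, pairVec i k⟫ = 1 := by
    rw [pairVec_comm j, pairVec_comm i, stdForm_pairVec_of_common hjk.symm hik.symm hij.symm]
  simp only [LinearMap.add_apply, Module.End.mul_apply, wedgeEnd_apply, hikij, hikjn hil hkl,
    hikjn him hkm, one_smul, zero_smul, add_zero, hji hjl hil, hji hjm him,
    stdForm_pairVec_of_common hjl hjk hkl.symm, stdForm_pairVec_of_common hjm hjk hkm.symm,
    stdForm_pairVec_of_common hjm hjl hlm.symm, map_add, hjkik,
    stdForm_comm (pairVec j l) (pairVec i k), stdForm_comm (pairVec i j) (pairVec i k)]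
  decide

variable {e : Red V 2 ≃+ StdSpace d}

theorem layer_two_not_le_alternatingEnd (hd : 5 ≤ d) (hB : B.IsAlt)
    (he : ∀ v w : V, stdForm d (redVec e v) (redVec e w) = PadicInt.toZMod (B v w))
    (hle : alternatingEnd (stdForm d) ≤ layer e G 0) :
    ¬ layer e G 2 ≤ alternatingEnd (stdForm d) := by
  intro hlayer
  obtain ⟨i, j, hij⟩ : ∃ i j : Fin d, i ≠ j := ⟨⟨0, by lia⟩, ⟨1, by lia⟩, by simp⟩
  obtain ⟨k, hik, hjk, -, -⟩ := exists_ne_four hd i j i j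
  obtain ⟨l, hil, hjl, hkl, -⟩ := exists_ne_four hd i j k k
  obtain ⟨m, him, hjm, hkm, hlm⟩ := exists_ne_four hd i j k l
  have halt : ∀ y, pairVec i j ⋏ y ∈ alternatingEnd (stdForm d) :=
    wedgeEnd_mem_alternatingEnd stdForm_isSymm _
  have hidem : ∀ {y}, ⟪pairVec i j, y⟫ = 1 → IsIdempotentElem (pairVec i j ⋏ y) :=
    wedgeEnd_mul_self stdForm_isAlt stdForm_isSymm
  have hone : ∀ {n}, i ≠ n → j ≠ n → ⟪pairVec i j, pairVec j n⟫ = 1 := fun hin hjn => by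
    rw [pairVec_comm, stdForm_pairVec_of_common hij.symm hjn hin]
  have hzero := apply_mul_add_mul_add_mul_eq_zero he hB hlayer hle (halt (pairVec j k))
    (halt (pairVec j l)) (halt (pairVec j m)) (hidem (hone hik hjk)) (hidem (hone hil hjl))
    (hidem (hone him hjm))
    (by
      rw [← map_add, ← map_add]
      exact hidem (by rw [map_add, map_add, hone hik hjk, hone hil hjl, hone him hjm]; decide))
    (pairVec i k)
  rw [stdForm_wedgeEnd_mul_add_mul_add_mul hij hik hil him hjk hjl hjm hkl hkm hlm] at hzero
  exact one_ne_zero hzero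

end ThirdLayer

section ReductionImages

variable {V : Type*} [AddCommGroup V] [Module ℤ_[2] V]
  {B : V →ₗ[ℤ_[2]] V →ₗ[ℤ_[2]] ℤ_[2]} {G H : Subgroup (Sp B)} {m n : ℕ}

instance (m : ℕ) : (Gam B m).Normal := MonoidHom.normal_ker _

theorem map_redSp_le_iff :
    G.map (redSp B m) ≤ H.map (redSp B m) ↔ ∀ g ∈ G, ∃ h ∈ H, g⁻¹ * h ∈ Gam B m := by
  rw [Subgroup.map_le_iff_le_comap]
  refine forall₂_congr fun g _ => exists_congr fun h => and_congr_right fun _ => ?_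
  rw [eq_comm, redSp_eq_iff]

theorem map_redSp_le_of_le (hmn : m ≤ n)
    (h : G.map (redSp B (2 ^ n)) ≤ H.map (redSp B (2 ^ n))) :
    G.map (redSp B (2 ^ m)) ≤ H.map (redSp B (2 ^ m)) :=
  Subgroup.map_le_map_iff.2
    ((Subgroup.map_le_map_iff.1 h).trans (sup_le_sup_left (Gam_antitone hmn) _))

theorem map_redSp_map_conj {u : Sp B} (hu : u ∈ Gam B m) :
    (G.map (MulAut.conj u).toMonoidHom).map (redSp B m) = G.map (redSp B m) := by
  have hu' : redSp B m u = 1 := hu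
  rw [Subgroup.map_map]
  congr 1
  refine MonoidHom.ext fun a => ?_
  simp [hu']

theorem Gam_le_map_conj (h : Gam B m ≤ G) (u : Sp B) :
    Gam B m ≤ G.map (MulAut.conj u).toMonoidHom :=
  (Subgroup.Normal.map_conj_eq (Gam B m) u).ge.trans (Subgroup.map_mono h)

variable [Module.Free ℤ_[2] V] {W : Type*} [AddCommGroup W] [Module (ZMod 2) W] {e : Red V 2 ≃+ W}

theorem map_redSp_le_of_layer_le
    (hGH : G.map (redSp B (2 ^ (n + 2))) ≤ H.map (redSp B (2 ^ (n + 2))))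
    (hHG : H.map (redSp B (2 ^ (n + 1))) ≤ G.map (redSp B (2 ^ (n + 1))))
    (hlayer : layer e H n ≤ layer e G n) :
    H.map (redSp B (2 ^ (n + 2))) ≤ G.map (redSp B (2 ^ (n + 2))) := by
  rw [map_redSp_le_iff] at *
  intro h hh
  obtain ⟨g, hg, hhg⟩ := hHG h hh
  obtain ⟨h', hh', hgh'⟩ := hGH g hg
  have hmem : h'⁻¹ * h ∈ Gam B (2 ^ (n + 1)) := by
    have hgh'' := redSp_eq_iff.2 (Gam_antitone (Nat.le_succ _) hgh')
    exact redSp_eq_iff.1 (((redSp_eq_iff.2 hhg).trans hgh'').symm)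
  obtain ⟨X, hX⟩ := exists_isSymbol e hmem
  obtain ⟨g', hg', hX'⟩ := hlayer (mem_layer_iff.2 ⟨_, mul_mem (inv_mem hh') hh, hX⟩)
  refine ⟨g * g', mul_mem hg hg', ?_⟩
  rw [← redSp_eq_iff, map_mul, redSp_eq_iff.2 hgh',
    redSp_eq_iff.2 (hX'.inv_mul_mem_Gam n.succ_ne_zero hX), ← map_mul, mul_inv_cancel_left]

theorem eq_of_map_redSp_eight_le (hG : Gam B (2 ^ 3) ≤ G) (hH : Gam B (2 ^ 3) ≤ H)
    (h₀ : layer e H 0 ≤ layer e G 0) (h₁ : layer e H 1 ≤ layer e G 1)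
    (hHG : H.map (redSp B 2) ≤ G.map (redSp B 2))
    (hGH : G.map (redSp B (2 ^ 3)) ≤ H.map (redSp B (2 ^ 3))) : G = H := by
  refine Subgroup.map_injective_of_ker_le _ hG hH (le_antisymm hGH ?_)
  exact map_redSp_le_of_layer_le hGH
    (map_redSp_le_of_layer_le (map_redSp_le_of_le (Nat.le_succ 2) hGH) hHG h₀) h₁

end ReductionImages

/-! ### Conjugacy -/

section Conjugacy

variable {d : ℕ} {V : Type*} [AddCommGroup V] [Module ℤ_[2] V]
  {B : V →ₗ[ℤ_[2]] V →ₗ[ℤ_[2]] ℤ_[2]} {e : Red V 2 ≃+ StdSpace d} {G H : Subgroup (Sp B)} {n : ℕ}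
  {g g' : Sp B} {σ : Equiv.Perm (Fin d)} {w w' : StdSpace d}

theorem isDiagonal_permConj (σ : Equiv.Perm (Fin d)) {X : Module.End (ZMod 2) (StdSpace d)}
    (hX : IsDiagonal (stdForm d) X w) :
    IsDiagonal (stdForm d) (permConj σ X) (permStd σ w) := fun x => by
  rw [permConj_apply, stdForm_permStd_left, hX, stdForm_permStd_left, inv_inv]

/-- `w` is the obstruction to moving `g` into `H` modulo `2 ^ (n + 2)` when the layer of `H` at `n`
consists of the alternating maps: `g⁻¹ h` has a symbol at level `n + 1` with diagonal `w`, for some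
`h ∈ H`. -/
def IsCrossDiagonal (e : Red V 2 ≃+ StdSpace d) (H : Subgroup (Sp B)) (n : ℕ) (g : Sp B)
    (w : StdSpace d) : Prop :=
  ∃ h ∈ H, ∃ X, IsSymbol e (n + 1) (g⁻¹ * h) X ∧ IsDiagonal (stdForm d) X w

theorem IsCrossDiagonal.mul (hw : IsCrossDiagonal e H n g w) (hw' : IsCrossDiagonal e H n g' w')
    (hσ : Lifts e g' σ) : IsCrossDiagonal e H n (g * g') (permStd σ⁻¹ w + w') := by
  obtain ⟨h, hh, X, hX, hXw⟩ := hw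
  obtain ⟨h', hh', X', hX', hXw'⟩ := hw'
  refine ⟨h * h', mul_mem hh hh', _, ?_, (isDiagonal_permConj σ⁻¹ hXw).add hXw'⟩
  convert (hX.conj_of_lifts hσ.inv).mul n.succ_ne_zero hX' using 1
  group

/-- The pairs of a symbol at level one of some `a ∈ G` and a cross diagonal of `a`. -/
def crossDiagonalGraph (e : Red V 2 ≃+ StdSpace d) (G H : Subgroup (Sp B)) :
    Submodule (ZMod 2) (Module.End (ZMod 2) (StdSpace d) × StdSpace d) :=
  AddSubgroup.toZModSubmodule 2
    { carrier := {p | ∃ a ∈ G, IsSymbol e 1 a p.1 ∧ IsCrossDiagonal e H 1 a p.2}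
      add_mem' := by
        rintro ⟨X, x⟩ ⟨Y, y⟩ ⟨a, ha, hX, hx⟩ ⟨b, hb, hY, hy⟩
        have hxy := hx.mul hy (hY.lifts_one one_ne_zero)
        rw [inv_one, permStd_one] at hxy
        exact ⟨a * b, mul_mem ha hb, hX.mul one_ne_zero hY, hxy⟩
      zero_mem' := ⟨1, one_mem _, isSymbol_one, 1, one_mem _, 0,
        by rw [inv_one, one_mul]; exact isSymbol_one, isDiagonal_zero_iff.2 (zero_mem _)⟩
      neg_mem' := fun {p} hp => by rwa [ZModModule.neg_eq_self p] }

theorem mem_crossDiagonalGraph_iff {X : Module.End (ZMod 2) (StdSpace d)} :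
    (X, w) ∈ crossDiagonalGraph e G H ↔ ∃ a ∈ G, IsSymbol e 1 a X ∧ IsCrossDiagonal e H 1 a w :=
  Iff.rfl

theorem layer_map_conj {u : Sp B} (hu : u ∈ Gam B 2) (G : Subgroup (Sp B)) :
    layer e (G.map (MulAut.conj u).toMonoidHom) n = layer e G n := by
  have hu1 : Lifts e u 1 := lifts_one_iff.2 hu
  have hone : ∀ X : Module.End (ZMod 2) (StdSpace d), permConj 1 X = X := fun X =>
    LinearMap.ext fun x => by rw [permConj_apply, inv_one, permStd_one, permStd_one]
  refine le_antisymm ?_ ?_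
  · rintro X ⟨_, ⟨a, ha, rfl⟩, hX⟩
    have hconj := hX.conj_of_lifts hu1.inv
    rw [inv_one, hone] at hconj
    refine ⟨a, ha, ?_⟩
    convert hconj using 1
    simp [mul_assoc]
  · rintro X ⟨a, ha, hX⟩
    have hconj := hX.conj_of_lifts hu1
    rw [hone] at hconj
    exact ⟨_, ⟨a, ha, rfl⟩, hconj⟩

variable [Module.Free ℤ_[2] V]

theorem IsCrossDiagonal.inv (hw : IsCrossDiagonal e H n g w) (hσ : Lifts e g σ) :
    IsCrossDiagonal e H n g⁻¹ (permStd σ w) := by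
  obtain ⟨h, hh, X, hX, hXw⟩ := hw
  refine ⟨h⁻¹, inv_mem hh, _, ?_, isDiagonal_permConj σ hXw⟩
  convert (hX.inv n.succ_ne_zero).conj_of_lifts hσ using 1
  group

theorem IsCrossDiagonal.conj_of_isSymbol {u : Sp B} {U : Module.End (ZMod 2) (StdSpace d)}
    {x : StdSpace d} (hw : IsCrossDiagonal e H n g w) (hσ : Lifts e g σ)
    (hU : IsSymbol e (n + 1) u U) (hx : IsDiagonal (stdForm d) U x) :
    IsCrossDiagonal e H n (u * g * u⁻¹) (x + permStd σ⁻¹ x + w) := by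
  obtain ⟨h, hh, X, hX, hXw⟩ := hw
  refine ⟨h, hh, _, ?_, (hx.add (isDiagonal_permConj σ⁻¹ hx)).add hXw⟩
  convert (hU.mul n.succ_ne_zero ((hU.inv n.succ_ne_zero).conj_of_lifts hσ.inv)).mul
    n.succ_ne_zero hX using 1
  group

theorem IsCrossDiagonal.exists_inv_mul_mem_Gam (hH : alternatingEnd (stdForm d) ≤ layer e H n)
    (hg : IsCrossDiagonal e H n g 0) : ∃ h ∈ H, g⁻¹ * h ∈ Gam B (2 ^ (n + 2)) := by
  obtain ⟨h, hh, X, hX, hX0⟩ := hg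
  obtain ⟨h', hh', hX'⟩ := hH (isDiagonal_zero_iff.1 hX0)
  refine ⟨h * h'⁻¹, mul_mem hh (inv_mem hh'), ?_⟩
  rw [← isSymbol_zero_iff (e := e), ← mul_assoc, ← ZModModule.add_self X]
  exact hX.mul n.succ_ne_zero (hX'.inv n.succ_ne_zero)

theorem isCrossDiagonal_zero_of_mem (hG : layer e G n ≤ alternatingEnd (stdForm d)) (hg : g ∈ G)
    (hgΓ : g ∈ Gam B (2 ^ (n + 1))) : IsCrossDiagonal e H n g 0 := by
  obtain ⟨X, hX⟩ := exists_isSymbol e hgΓ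
  refine ⟨1, one_mem _, X, ?_, isDiagonal_zero_iff.2 (hG (mem_layer_iff.2 ⟨g, hg, hX⟩))⟩
  rw [mul_one]
  exact hX.inv n.succ_ne_zero

theorem IsCrossDiagonal.unique (hH : layer e H n ≤ alternatingEnd (stdForm d))
    (hw : IsCrossDiagonal e H n g w) (hw' : IsCrossDiagonal e H n g w') : w = w' := by
  obtain ⟨h, hh, X, hX, hXw⟩ := hw
  obtain ⟨h', hh', X', hX', hXw'⟩ := hw'
  have hsymbol := (hX.inv n.succ_ne_zero).mul n.succ_ne_zero hX'
  have halt : X + X' ∈ alternatingEnd (stdForm d) :=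
    hH (mem_layer_iff.2 ⟨h⁻¹ * h', mul_mem (inv_mem hh) hh', by convert hsymbol using 1; group⟩)
  have hsum := (hXw.add hXw').unique stdForm_nondegenerate (isDiagonal_zero_iff.2 halt)
  rwa [← ZModModule.sub_eq_add, sub_eq_zero] at hsum

variable
  (he : ∀ v w : V, stdForm d (redVec e v) (redVec e w) = PadicInt.toZMod (B v w))

include he

theorem exists_isCrossDiagonal
    (hGH : G.map (redSp B (2 ^ (n + 1))) ≤ H.map (redSp B (2 ^ (n + 1)))) (hg : g ∈ G) :
    ∃ w, IsCrossDiagonal e H n g w := by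
  obtain ⟨h, hh, hgh⟩ := map_redSp_le_iff.1 hGH g hg
  obtain ⟨X, hX⟩ := exists_isSymbol e hgh
  obtain ⟨w, hw⟩ := exists_isDiagonal stdForm_isSymm stdForm_nondegenerate
    (hX.mem_selfAdjointSubmodule he n.succ_ne_zero)
  exact ⟨w, h, hh, X, hX, hw⟩

theorem IsCrossDiagonal.of_lifts
    (hGH : G.map (redSp B (2 ^ (n + 1))) ≤ H.map (redSp B (2 ^ (n + 1))))
    (hvan : ∀ g ∈ G, Lifts e g 1 → ∀ w, IsCrossDiagonal e H n g w → w = 0) (hg : g ∈ G)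
    (hg' : g' ∈ G) (hσ : Lifts e g σ) (hσ' : Lifts e g' σ) (hw : IsCrossDiagonal e H n g w) :
    IsCrossDiagonal e H n g' w := by
  have hone := hσ.inv.mul hσ'
  rw [inv_mul_cancel] at hone
  have hmem := mul_mem (inv_mem hg) hg'
  obtain ⟨w', hw'⟩ := exists_isCrossDiagonal he hGH hmem
  have hprod := hw.mul hw' hone
  rwa [mul_inv_cancel_left, hvan _ hmem hone w' hw', inv_one, permStd_one, add_zero] at hprod

theorem exists_isCrossDiagonal_coboundary (hd : 5 ≤ d) (hodd : Odd d)
    (hGs : ∀ σ, ∃ g ∈ G, Lifts e g σ)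
    (hGH : G.map (redSp B (2 ^ (n + 1))) ≤ H.map (redSp B (2 ^ (n + 1))))
    (hH : layer e H n ≤ alternatingEnd (stdForm d))
    (hvan : ∀ g ∈ G, Lifts e g 1 → ∀ w, IsCrossDiagonal e H n g w → w = 0) :
    ∃ x, ∀ g ∈ G, ∀ σ, Lifts e g σ → IsCrossDiagonal e H n g (permStd σ⁻¹ x + x) := by
  choose s hsG hsσ using hGs
  choose ψ hψ using fun σ => exists_isCrossDiagonal he hGH (hsG σ)
  obtain ⟨x, hx⟩ := exists_of_crossedHom (ψ := ψ) (fun σ τ =>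
    (hψ (σ * τ)).unique hH (((hψ σ).mul (hψ τ) (hsσ τ)).of_lifts he hGH hvan
      (mul_mem (hsG σ) (hsG τ)) (hsG _) ((hsσ σ).mul (hsσ τ)) (hsσ _))) hd hodd
  refine ⟨x, fun g hg σ hσ => ?_⟩
  rw [← hx]
  exact (hψ σ).of_lifts he hGH hvan (hsG σ) hg (hsσ σ) hσ

theorem exists_conj_map_redSp_le (hd : 5 ≤ d) (hodd : Odd d) (hB : B.IsAlt)
    (hG : G.map (redSp B 2) = stdImage B d e)
    (hGH : G.map (redSp B (2 ^ (n + 1))) ≤ H.map (redSp B (2 ^ (n + 1))))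
    (hH : layer e H n = alternatingEnd (stdForm d))
    (hvan : ∀ g ∈ G, Lifts e g 1 → ∀ w, IsCrossDiagonal e H n g w → w = 0) :
    ∃ u ∈ Gam B (2 ^ (n + 1)), (G.map (MulAut.conj u).toMonoidHom).map (redSp B (2 ^ (n + 2))) ≤
      H.map (redSp B (2 ^ (n + 2))) := by
  obtain ⟨x, hx⟩ := exists_isCrossDiagonal_coboundary he hd hodd (exists_lifts hB he hG.ge) hGH
    hH.le hvan
  obtain ⟨y, rfl⟩ := redVec_surjective (e := e) x
  have hu := isSymbol_transvection hB he (n + 1) y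
  refine ⟨_, hu.mem_Gam, map_redSp_le_iff.2 ?_⟩
  rintro _ ⟨g, hg, rfl⟩
  obtain ⟨σ, hσ⟩ := redSp_mem_stdImage_iff.1 (hG.le (Subgroup.mem_map_of_mem _ hg))
  refine IsCrossDiagonal.exists_inv_mul_mem_Gam hH.ge ?_
  have hconj := (hx g hg σ hσ).conj_of_isSymbol hσ hu (isDiagonal_squareEnd stdForm_isSymm _)
  rwa [add_comm (redVec e y), ZModModule.add_self] at hconj

theorem isEquivariantGraph_crossDiagonalGraph (hGs : ∀ σ, ∃ g ∈ G, Lifts e g σ)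
    (hGH : G.map (redSp B (2 ^ 2)) ≤ H.map (redSp B (2 ^ 2)))
    (hG : layer e G 1 ≤ alternatingEnd (stdForm d))
    (hH : layer e H 1 ≤ alternatingEnd (stdForm d)) :
    IsEquivariantGraph (crossDiagonalGraph e G H) where
  permConj_mem σ X y := by
    rintro ⟨a, ha, hX, hy⟩
    obtain ⟨s, hs, hσ⟩ := hGs σ
    obtain ⟨z, hz⟩ := exists_isCrossDiagonal (n := 1) he hGH hs
    refine ⟨s * a * s⁻¹, mul_mem (mul_mem hs ha) (inv_mem hs), hX.conj_of_lifts hσ, ?_⟩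
    have hconj := (hz.mul hy (hX.lifts_one one_ne_zero)).mul (hz.inv hσ) hσ.inv
    rwa [inv_one, permStd_one, inv_inv, map_add, add_right_comm, ZModModule.add_self,
      zero_add] at hconj
  eq_zero_of_zero y := by
    rintro ⟨a, ha, hX, hy⟩
    exact hy.unique hH (isCrossDiagonal_zero_of_mem hG ha (isSymbol_zero_iff.1 hX))

theorem eq_zero_of_isCrossDiagonal_one (hd : 5 ≤ d) (hGs : ∀ σ, ∃ g ∈ G, Lifts e g σ)
    (hGH : G.map (redSp B (2 ^ 2)) ≤ H.map (redSp B (2 ^ 2)))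
    (hG₀ : layer e G 0 = alternatingEnd (stdForm d))
    (hG₁ : layer e G 1 ≤ alternatingEnd (stdForm d))
    (hH : layer e H 1 ≤ alternatingEnd (stdForm d)) (hg : g ∈ G) (hg1 : Lifts e g 1)
    (hw : IsCrossDiagonal e H 1 g w) : w = 0 := by
  obtain ⟨X, hX⟩ := exists_isSymbol (n := 1) e (lifts_one_iff.1 hg1)
  refine (isEquivariantGraph_crossDiagonalGraph he hGs hGH hG₁ hH).eq_zero hd ?_
    (hG₀.le (mem_layer_iff.2 ⟨g, hg, hX⟩)) (mem_crossDiagonalGraph_iff.2 ⟨g, hg, hX, hw⟩)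
  rintro Y hY
  obtain ⟨a, ha, haY⟩ := hG₀.ge hY
  obtain ⟨y, hy⟩ := exists_isCrossDiagonal (n := 1) he hGH ha
  exact ⟨y, a, ha, haY, hy⟩

theorem exists_conj_map_redSp_eight_le (hd : 5 ≤ d) (hodd : Odd d) (hB : B.IsAlt)
    (hG : G.map (redSp B 2) = stdImage B d e) (hH : H.map (redSp B 2) = stdImage B d e)
    (hG₀ : layer e G 0 = alternatingEnd (stdForm d))
    (hG₁ : layer e G 1 = alternatingEnd (stdForm d))
    (hH₀ : layer e H 0 = alternatingEnd (stdForm d))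
    (hH₁ : layer e H 1 = alternatingEnd (stdForm d)) :
    ∃ u ∈ Gam B 2, (G.map (MulAut.conj u).toMonoidHom).map (redSp B (2 ^ 3)) ≤
      H.map (redSp B (2 ^ 3)) := by
  obtain ⟨u, hu, huG⟩ := exists_conj_map_redSp_le (n := 0) he hd hodd hB hG (hG.trans hH.symm).le
    hH₀ fun g hg hg1 w hw =>
      hw.unique hH₀.le (isCrossDiagonal_zero_of_mem hG₀.le hg (lifts_one_iff.1 hg1))
  have hu2 : u ∈ Gam B 2 := hu
  have hG' := (map_redSp_map_conj hu2).trans hG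
  obtain ⟨u', hu', huG'⟩ := exists_conj_map_redSp_le (n := 1) he hd hodd hB hG' huG hH₁
    fun g hg hg1 w => eq_zero_of_isCrossDiagonal_one he hd (exists_lifts hB he hG'.ge) huG
      ((layer_map_conj hu2 G).trans hG₀) ((layer_map_conj hu2 G).trans hG₁).le hH₁.le hg hg1
  refine ⟨u' * u, mul_mem (Gam_antitone one_le_two hu') hu, ?_⟩
  have hmul : G.map (MulAut.conj (u' * u)).toMonoidHom =
      (G.map (MulAut.conj u).toMonoidHom).map (MulAut.conj u').toMonoidHom := by
    rw [map_mul, Subgroup.map_map]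
    rfl
  rwa [hmul]

theorem exists_conj_eq (hd : 5 ≤ d) (hodd : Odd d) (hB : B.IsAlt)
    (hG : G.map (redSp B 2) = stdImage B d e) (hH : H.map (redSp B 2) = stdImage B d e)
    (hG₀ : layer e G 0 = alternatingEnd (stdForm d))
    (hG₁ : layer e G 1 = alternatingEnd (stdForm d))
    (hH₀ : layer e H 0 = alternatingEnd (stdForm d))
    (hH₁ : layer e H 1 = alternatingEnd (stdForm d))
    (hG8 : Gam B (2 ^ 3) ≤ G) (hH8 : Gam B (2 ^ 3) ≤ H) :
    ∃ u ∈ Gam B 2, H = G.map (MulAut.conj u).toMonoidHom := by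
  obtain ⟨u, hu, huG⟩ := exists_conj_map_redSp_eight_le he hd hodd hB hG hH hG₀ hG₁ hH₀ hH₁
  refine ⟨u, hu, (eq_of_map_redSp_eight_le (e := e) (Gam_le_map_conj hG8 u) hH8 ?_ ?_ ?_ huG).symm⟩
  · rw [layer_map_conj hu, hG₀, hH₀]
  · rw [layer_map_conj hu, hG₁, hH₁]
  · rw [map_redSp_map_conj hu, hG, hH]

end Conjugacy

/-! ### Orders -/

section Orders

variable {d : ℕ}

theorem stdRep_injective (hd : 5 ≤ d) : Function.Injective (stdRep d) := by
  refine (injective_iff_map_eq_one _).2 fun σ hσ => Equiv.ext fun i => ?_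
  have hpair : ∀ j, pairVec (σ i) (σ j) = pairVec i j := fun j => by
    rw [← permStd_pairVec]
    exact LinearEquiv.congr_fun (congrArg Subtype.val hσ) _
  by_contra hi
  rw [Equiv.Perm.one_apply] at hi
  obtain ⟨j, hij, hj, -, -⟩ := exists_ne_four hd i (σ⁻¹ i) i i
  have hji : σ j ≠ i := fun h => hj (Equiv.Perm.inv_eq_iff_eq.2 h.symm)
  obtain ⟨m, him, hjm, hσim, hσjm⟩ := exists_ne_four hd i j (σ i) (σ j)
  have hone := stdForm_pairVec_of_common hij him hjm
  rw [← hpair, stdForm_pairVec_of_disjoint hi hσim hji hσjm] at hone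
  exact zero_ne_one hone

theorem finrank_sumZero (hd : 0 < d) : Module.finrank (ZMod 2) (sumZero d) = d - 1 := by
  let f : (Fin d → ZMod 2) →ₗ[ZMod 2] ZMod 2 := ∑ i, LinearMap.proj i
  have hf : ∀ w, f w = ∑ i, w i := fun w => by simp [f, LinearMap.sum_apply]
  have hker : LinearMap.ker f = sumZero d := Submodule.ext fun w => by
    rw [LinearMap.mem_ker, hf]
    rfl
  have hsurj : Function.Surjective f := fun c =>
    ⟨Pi.single ⟨0, hd⟩ c, by rw [hf, Finset.sum_pi_single']; simp⟩
  have hrank := f.finrank_range_add_finrank_ker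
  rw [LinearMap.range_eq_top.2 hsurj, finrank_top, hker, Module.finrank_self,
    Module.finrank_fin_fun] at hrank
  lia

theorem finrank_stdSpace (hd : Odd d) : Module.finrank (ZMod 2) (StdSpace d) = d - 1 := by
  have hquot := (onesLine d).finrank_quotient_add_finrank
  rw [Submodule.finrank_eq_zero.2 (onesLine_eq_bot_of_odd hd), add_zero,
    finrank_sumZero hd.pos] at hquot
  exact hquot

section Layers

variable {W : Type*} [AddCommGroup W] [Module (ZMod 2) W] {V : Type*} [AddCommGroup V]
  [Module ℤ_[2] V] [Module.Free ℤ_[2] V] {B : V →ₗ[ℤ_[2]] V →ₗ[ℤ_[2]] ℤ_[2]}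

theorem relIndex_Gam_eq_card_layer (e : Red V 2 ≃+ W) (G : Subgroup (Sp B)) (n : ℕ) :
    (Gam B (2 ^ (n + 2))).relIndex (Gam B (2 ^ (n + 1)) ⊓ G) = Nat.card (layer e G n) := by
  unfold Gam
  rw [Subgroup.relIndex_ker]
  choose s hsG hs using fun X : layer e G n => X.2
  let f : layer e G n → (Gam B (2 ^ (n + 1)) ⊓ G).map (redSp B (2 ^ (n + 2))) := fun X =>
    ⟨redSp B _ (s X), s X, ⟨(hs X).mem_Gam, hsG X⟩, rfl⟩
  have hf : Function.Bijective f := by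
    constructor
    · intro X Y h
      have hXY := (hs X).of_inv_mul_mem_Gam n.succ_ne_zero
        (redSp_eq_iff.1 (congrArg Subtype.val h))
      exact Subtype.ext (hXY.unique (hs Y))
    · rintro ⟨_, a, ⟨haΓ, haG⟩, rfl⟩
      obtain ⟨X, hX⟩ := exists_isSymbol e haΓ
      exact ⟨⟨X, a, haG, hX⟩, Subtype.ext (redSp_eq_iff.2
        ((hs _).inv_mul_mem_Gam n.succ_ne_zero hX))⟩
  exact (Nat.card_eq_of_bijective f hf).symm

theorem relIndex_Gam_succ (e : Red V 2 ≃+ W) (G : Subgroup (Sp B)) (n : ℕ) :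
    (Gam B (2 ^ (n + 2))).relIndex G =
      Nat.card (layer e G n) * (Gam B (2 ^ (n + 1))).relIndex G := by
  rw [← relIndex_Gam_eq_card_layer, Subgroup.relIndex_inf_mul_relIndex,
    inf_eq_left.2 (Gam_antitone (Nat.le_succ _))]

theorem card_map_redSp_eight_eq (e : Red V 2 ≃+ W) (G : Subgroup (Sp B)) :
    Nat.card (G.map (redSp B 8)) =
      Nat.card (layer e G 1) * (Nat.card (layer e G 0) * Nat.card (G.map (redSp B 2))) := by
  rw [← Subgroup.relIndex_ker, ← Subgroup.relIndex_ker]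
  exact (relIndex_Gam_succ e G 1).trans (congrArg _ (relIndex_Gam_succ e G 0))

end Layers

variable {V : Type*} [AddCommGroup V] [Module ℤ_[2] V]
  {B : V →ₗ[ℤ_[2]] V →ₗ[ℤ_[2]] ℤ_[2]} {e : Red V 2 ≃+ StdSpace d} {G : Subgroup (Sp B)}

theorem card_map_redSp_two (hd : 5 ≤ d) (hG : G.map (redSp B 2) ≤ stdImage B d e)
    (hGs : ∀ σ, ∃ g ∈ G, Lifts e g σ) : Nat.card (G.map (redSp B 2)) = d.factorial := by
  choose s hsG hs using hGs
  let f : Equiv.Perm (Fin d) → G.map (redSp B 2) := fun σ => ⟨redSp B 2 (s σ), s σ, hsG σ, rfl⟩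
  have hf : Function.Bijective f := by
    constructor
    · intro σ τ h
      have hστ := (hs σ).of_redSp_eq (congrArg Subtype.val h)
      refine stdRep_injective hd (Subtype.ext (LinearEquiv.ext
        ((redVec_surjective (e := e)).forall.2 fun v => ?_)))
      exact (hστ v).symm.trans (hs τ v)
    · rintro ⟨_, a, ha, rfl⟩
      obtain ⟨σ, hσ⟩ := redSp_mem_stdImage_iff.1 (hG ⟨a, ha, rfl⟩)
      refine ⟨σ, Subtype.ext (redSp_eq_iff.2 ?_)⟩
      have hone := (hs σ).inv.mul hσ
      rwa [inv_mul_cancel, lifts_one_iff] at hone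
  rw [← Nat.card_eq_of_bijective f hf, Nat.card_perm, Nat.card_fin]

theorem two_mul_choose_two_mul_two (g : ℕ) : 2 * (2 * g).choose 2 = 4 * g ^ 2 - 2 * g := by
  rw [Nat.choose_two_right, Nat.mul_div_cancel' (Nat.even_mul_pred_self _).two_dvd,
    Nat.mul_sub_one]
  ring_nf

theorem card_map_redSp_eight [Module.Free ℤ_[2] V] (hd : 5 ≤ d) {g : ℕ} (hg : d = 2 * g + 1)
    (hG : G.map (redSp B 2) ≤ stdImage B d e) (hGs : ∀ σ, ∃ g ∈ G, Lifts e g σ)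
    (h₀ : layer e G 0 = alternatingEnd (stdForm d))
    (h₁ : layer e G 1 = alternatingEnd (stdForm d)) :
    Nat.card (G.map (redSp B 8)) = d.factorial * 2 ^ (4 * g ^ 2 - 2 * g) := by
  rw [card_map_redSp_eight_eq e, h₀, h₁, card_map_redSp_two hd hG hGs,
    card_alternatingEnd stdForm_isSymm stdForm_nondegenerate, finrank_stdSpace ⟨g, hg⟩, ← mul_assoc,
    ← pow_add, mul_comm, ← two_mul, hg, Nat.add_sub_cancel, two_mul_choose_two_mul_two]

end Orders

section ClosedSubgroups

variable {d : ℕ} {V : Type*} [AddCommGroup V] [Module ℤ_[2] V] [Module.Free ℤ_[2] V]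
  {B : V →ₗ[ℤ_[2]] V →ₗ[ℤ_[2]] ℤ_[2]} {e : Red V 2 ≃+ StdSpace d} {G : Subgroup (Sp B)}

theorem Gam_two_le (hd : 5 ≤ d)
    (he : ∀ v w : V, stdForm d (redVec e v) (redVec e w) = PadicInt.toZMod (B v w))
    (hG : ∀ σ, ∃ g ∈ G, Lifts e g σ) (hclosed : IsClosed[twoAdic B] (G : Set (Sp B)))
    (h : (stdForm d).selfAdjointSubmodule ≤ layer e G 0) : Gam B 2 ≤ G := by
  refine Gam_le_of_layers (n := 0) he hclosed fun m _ => ?_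
  rcases m.eq_zero_or_pos with rfl | hm
  · exact h
  · exact (selfAdjointSubmodule_le_layer_one hd hG h).trans (layer_le_layer one_ne_zero hm)

theorem layers_of_not_Gam_four_le (hd : 5 ≤ d) (hB : B.IsAlt)
    (he : ∀ v w : V, stdForm d (redVec e v) (redVec e w) = PadicInt.toZMod (B v w))
    (hG : ∀ σ, ∃ g ∈ G, Lifts e g σ) (hclosed : IsClosed[twoAdic B] (G : Set (Sp B)))
    (hG4 : ¬ Gam B (2 ^ 2) ≤ G) :
    layer e G 0 = alternatingEnd (stdForm d) ∧ layer e G 1 = alternatingEnd (stdForm d) ∧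
      Gam B (2 ^ 3) ≤ G := by
  have hfull := fun n => (permStable_layer hG n).selfAdjointSubmodule_le_of_not_le
    (layer_le_selfAdjointSubmodule he)
  have halt₀ := alternatingEnd_le_layer_zero hd hB he hG
  have h₀ : layer e G 0 ≤ alternatingEnd (stdForm d) := by
    by_contra hnot
    exact hG4 ((Gam_antitone one_le_two).trans
      (Gam_two_le hd he hG hclosed (hfull 0 halt₀ hnot)))
  have halt₁ := alternatingEnd_le_layer_one hd hB he hG h₀
  have h₁ : layer e G 1 ≤ alternatingEnd (stdForm d) := by
    by_contra hnot
    exact hG4 (Gam_le_of_layers he hclosed fun _ hm =>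
      (hfull 1 halt₁ hnot).trans (layer_le_layer one_ne_zero hm))
  have hfull₂ := hfull 2 (halt₁.trans (layer_le_layer_succ one_ne_zero))
    (layer_two_not_le_alternatingEnd hd hB he halt₀)
  exact ⟨h₀.antisymm halt₀, h₁.antisymm halt₁,
    Gam_le_of_layers he hclosed fun _ hm => hfull₂.trans (layer_le_layer two_ne_zero hm)⟩

theorem Gam_eight_le (hd : 5 ≤ d) (hB : B.IsAlt)
    (he : ∀ v w : V, stdForm d (redVec e v) (redVec e w) = PadicInt.toZMod (B v w))
    (hG : ∀ σ, ∃ g ∈ G, Lifts e g σ) (hclosed : IsClosed[twoAdic B] (G : Set (Sp B))) :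
    Gam B (2 ^ 3) ≤ G := by
  by_cases hG4 : Gam B (2 ^ 2) ≤ G
  · exact (Gam_antitone (by norm_num)).trans hG4
  · exact (layers_of_not_Gam_four_le hd hB he hG hclosed hG4).2.2

end ClosedSubgroups

theorem theorem1p1 (d g : ℕ) (hd : 3 ≤ d) (hg : g = (d - 1) / 2)
    {V : Type*} [AddCommGroup V] [Module ℤ_[2] V] [Module.Free ℤ_[2] V] [Module.Finite ℤ_[2] V]
    (hrank : Module.finrank ℤ_[2] V = 2 * g)
    (B : V →ₗ[ℤ_[2]] V →ₗ[ℤ_[2]] ℤ_[2]) (hB : ∀ v, B v v = 0)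
    (e : Red V 2 ≃+ StdSpace d)
    (he : ∀ v w : V, stdForm d (e ((multiples V 2).mkQ v)) (e ((multiples V 2).mkQ w))
      = PadicInt.toZMod (B v w)) :
    (∀ G : Subgroup (Sp B), IsClosed[twoAdic B] (G : Set (Sp B)) →
      stdImage B d e ≤ G.map (redSp B 2) →
        (6 ≤ d → Even d →
          G = (G.map (redSp B 2)).comap (redSp B 2) ∧
          IsOpen[twoAdic B] (G : Set (Sp B)) ∧ Gam B 2 ≤ G) ∧
        (5 ≤ d → Odd d →
          Gam B 8 ≤ G ∧ IsOpen[twoAdic B] (G : Set (Sp B)) ∧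
          (G.map (redSp B 2) = stdImage B d e → ¬ Gam B 4 ≤ G →
            Nat.card (G.map (redSp B 8)) = Nat.factorial d * 2 ^ (4 * g ^ 2 - 2 * g)))) ∧
    (5 ≤ d → Odd d → ∀ G H : Subgroup (Sp B),
      IsClosed[twoAdic B] (G : Set (Sp B)) → IsClosed[twoAdic B] (H : Set (Sp B)) →
      G.map (redSp B 2) = stdImage B d e → H.map (redSp B 2) = stdImage B d e →
      ¬ Gam B 4 ≤ G → ¬ Gam B 4 ≤ H →
        ∃ u ∈ (stdImage B d e).comap (redSp B 2),
          H = G.map (MulAut.conj u).toMonoidHom) := by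
  have hstd := fun {G} => exists_lifts (e := e) (G := G) hB he
  refine ⟨fun G hclosed hG => ⟨fun hd6 heven => ?_, fun hd5 hodd => ?_⟩,
    fun hd5 hodd G H hGc hHc hG hH hG4 hH4 => ?_⟩
  · have hfull := selfAdjointSubmodule_le_layer_zero (by lia) hB he (hstd hG) heven
    have h2 := Gam_two_le (by lia) he (hstd hG) hclosed hfull
    exact ⟨by rw [Subgroup.comap_map_eq]; exact (sup_eq_left.2 h2).symm,
      isOpen_of_Gam_le 1 h2, h2⟩
  · have h8 := Gam_eight_le hd5 hB he (hstd hG) hclosed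
    refine ⟨h8, isOpen_of_Gam_le 3 h8, fun hG2 hG4 => ?_⟩
    obtain ⟨h₀, h₁, -⟩ := layers_of_not_Gam_four_le hd5 hB he (hstd hG) hclosed hG4
    have hdg : d = 2 * g + 1 := by rcases hodd with ⟨k, rfl⟩; lia
    exact card_map_redSp_eight hd5 hdg hG2.le (hstd hG) h₀ h₁
  · obtain ⟨hG₀, hG₁, hG8⟩ := layers_of_not_Gam_four_le hd5 hB he (hstd hG.ge) hGc hG4
    obtain ⟨hH₀, hH₁, hH8⟩ := layers_of_not_Gam_four_le hd5 hB he (hstd hH.ge) hHc hH4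
    obtain ⟨u, hu, huG⟩ := exists_conj_eq he hd5 hodd hB hG hH hG₀ hG₁ hH₀ hH₁ hG8 hH8
    exact ⟨u, redSp_mem_stdImage_iff.2 ⟨1, lifts_one_iff.2 hu⟩, huG⟩
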